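/- For every $K\in(1,2)$ there exists a quasiregular map $f\colon\mathbb C\to\mathbb C$ of polynomial type (that is, $|f(z)|\to\infty$ as $z\to\infty$) with degree $\deg(f)=2$ and dilatation $K(f)=K$ such that $\infty\notin J(f)$, $$H_h(J(f))\le H_h(BO(f))<\infty\qquad\text{for}\qquad h(t)=\left(\log\frac1t\right)^{-\frac{\log 2}{\log K}},$$ and both $J(f)$ and $BO(f)$ have Hausdorff dimension $0$. Here $f$ is called $K'$-quasiregular, for $K'\ge 1$, if it is continuous, lies in the Sobolev space $W^{1,2}_{\mathrm{loc}}$ and satisfies $|Df|^2\le K' J_f$ almost everywhere, where $|Df|$ is the operator norm of the derivative and $J_f$ is the Jacobian determinant; $f$ is quasiregular if it is $K'$-quasiregular for some $K'\ge1$, and $K(f)$ is the least such $K'$. The degree $\deg(f)$ is the number of preimages of every point, counted with multiplicity (the multiplicity of a preimage $x$ being the local index $\inf_U\sup_y \operatorname{card}(f^{-1}(y)\cap U)$ over neighborhoods $U$ of $x$). Extending $f$ to the Riemann sphere $\overline{\mathbb C}=\mathbb C\cup\{\infty\}$ by $f(\infty)=\infty$, the Julia set $J(f)$ is the set of all $z\in\overline{\mathbb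 C}$ such that for every neighborhood $U$ of $z$ the set $\overline{\mathbb C}\setminus\bigcup_{k\ge0}f^k(U)$ has at most two points; $BO(f)$ is the set of all $z\in\mathbb C$ for which the sequence $(f^k(z))_{k\ge 0}$ is bounded; and $$H_h(A)=\lim_{\delta\to0}\inf\left\{\sum_{i=1}^\infty h(\operatorname{diam}A_i)\colon A\subset\bigcup_{i=1}^\infty A_i,\ \operatorname{diam}A_i<\delta\right\}$$ is the Hausdorff measure with respect to the gauge function $h$ (with $h(0)=0$) and the Euclidean diameter. -/

import Mathlib

open MeasureTheory Filter Topology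
open scoped ENNReal ContDiff

/-- `g` is a weak (distributional) derivative of `f : ℂ → ℂ`, where `ℂ` is regarded as the real
plane: integration by parts holds against every real test function in every direction. -/
def IsWeakDeriv (f : ℂ → ℂ) (g : ℂ → (ℂ →L[ℝ] ℂ)) : Prop :=
  ∀ φ : ℂ → ℝ, ContDiff ℝ ∞ φ → HasCompactSupport φ → ∀ v : ℂ,
    ∫ z, (fderiv ℝ φ z v) • f z = - ∫ z, φ z • g z v

/-- `f : ℂ → ℂ` is `K`-quasiregular: it is continuous, it belongs to the Sobolev space
`W^{1,2}_loc`, and its weak derivative satisfies `|Df|² ≤ K J_f` almost everywhere, with the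
operator norm `|Df|` and the Jacobian determinant `J_f`. -/
def IsKQuasiregular (K : ℝ) (f : ℂ → ℂ) : Prop :=
  Continuous f ∧
    ∃ g : ℂ → (ℂ →L[ℝ] ℂ),
      IsWeakDeriv f g ∧
      (∀ s : Set ℂ, IsCompact s → MemLp g 2 (volume.restrict s)) ∧
      ∀ᵐ z : ℂ, ‖g z‖ ^ 2 ≤ K * (g z).det

/-- `f : ℂ → ℂ` is quasiregular. -/
def IsQuasiregularMap (f : ℂ → ℂ) : Prop :=
  ∃ K : ℝ, 1 ≤ K ∧ IsKQuasiregular K f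

/-- `K(f) = K`: the dilatation of `f` is the least `K ≥ 1` for which `f` is `K`-quasiregular
(in the plane the outer and the inner dilatation coincide). -/
def HasDilatation (f : ℂ → ℂ) (K : ℝ) : Prop :=
  IsLeast {K' : ℝ | 1 ≤ K' ∧ IsKQuasiregular K' f} K

/-- `f` is of polynomial type: `|f(z)| → ∞` as `z → ∞`. -/
def IsPolynomialType (f : ℂ → ℂ) : Prop :=
  Tendsto (fun z => ‖f z‖) (cocompact ℂ) atTop

/-- The local index `i(x, f) = inf_U sup_y card (f⁻¹(y) ∩ U)`, where `U` runs through the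
neighbourhoods of `x`. -/
noncomputable def localIndex (f : ℂ → ℂ) (x : ℂ) : ℕ∞ :=
  ⨅ U ∈ 𝓝 x, ⨆ y : ℂ, (f ⁻¹' {y} ∩ U).encard

/-- `deg(f) = d`: every point has exactly `d` preimages, counted with multiplicity (that is,
according to the local index). -/
def HasDegree (f : ℂ → ℂ) (d : ℕ) : Prop :=
  ∀ y : ℂ, ∑' x : f ⁻¹' {y}, localIndex f (x : ℂ) = (d : ℕ∞)

/-- The Julia set of a self-map `F` of the Riemann sphere: the points all of whose neighbourhoods
have a forward orbit `⋃ k, F^k(U)` that misses at most two points of the sphere. -/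
def sphereJuliaSet (F : OnePoint ℂ → OnePoint ℂ) : Set (OnePoint ℂ) :=
  {z | ∀ U ∈ 𝓝 z, ((⋃ k : ℕ, F^[k] '' U)ᶜ).encard ≤ 2}

/-- The Julia set, as a subset of the Riemann sphere, of a map `f : ℂ → ℂ` of polynomial type,
which is extended to the sphere by `f(∞) = ∞`. -/
def juliaSet (f : ℂ → ℂ) : Set (OnePoint ℂ) :=
  sphereJuliaSet (OnePoint.map f)

/-- `BO(f)`, the set of points with bounded (forward) orbit. -/
def boundedOrbits (f : ℂ → ℂ) : Set ℂ :=
  {z | Bornology.IsBounded (Set.range fun k : ℕ => f^[k] z)}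

/-- The Hausdorff measure `H_h` on `ℂ` with respect to a gauge function `h`, which matters only on
an interval `(0, ε]` and is extended by its limit `h(0) = 0`. -/
noncomputable def gaugeMeasure (h : ℝ → ℝ) : Measure ℂ :=
  Measure.mkMetric fun t : ℝ≥0∞ => if t = 0 then 0 else ENNReal.ofReal (h t.toReal)

/-! Start from z² - b² with b large, make it affine on the discs of radius 2 about ±b, and insert
radial stretches at infinitely many scales inside these discs. Put r₀ = 4b and r_{n+1} = r_n / (b
2^{K^n}). A disc of radius r_n contains a concentric disc of radius b r_{n+1}, which contains two
discs of radius r_{n+1} with centres at distance b r_{n+1}/2 from the common centre. The annulus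
between the two concentric circles has radius quotient 2^{K^n}. The map f sends discs of level n+1
to discs of level n, hence annuli of quotient 2^{K^{n+1}} to annuli of quotient 2^{K^n}. The stretch
u|u|^{1/K-1} does exactly this, with dilatation K, and between the annuli the map is affine
(`isScale_cantorRadius`, `IsScale.cantorMap_inner`).

Size: a bounded orbit never leaves the disc of radius 4b, so pulling back repeatedly places BO(f) in
the union of the 2^l discs of each level l (`boundedOrbits_subset_cantorLevel`). The 2^{n+2} discs
of level n+2 have diameter at most 2^{-K^n}, where h is at most 2^{-n} (log 2)^{-log 2/log K}. The
sums stay bounded, and doubly exponential decay of the diameters gives dimension 0.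

Julia set: the complement of BO(f) in the sphere is open and forward invariant, and BO(f) has more
than two points, so J(f) ⊆ BO(f) and ∞ ∉ J(f).

Degree: f(z) = D(z²) with D bijective. For the affinized square, D is a translate of the identity
minus a contraction. The stretches contribute one more bijection, whose inverse is the same
construction with source and target exchanged (`IsScale.cantorMap_cantorMap`).

Dilatation: f is an infinite sum of Lipschitz bumps. The layers of derivatives are geometrically
summable in L², which is where K < 2 enters (`cantorRadius_decay`), so f has a weak derivative, the
a.e. limit of partial sums that all satisfy |A|² ≤ K det A. Away from ±b the affinized square is
within distortion K because b is large compared with 1/(K-1). On one annulus the derivative is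
explicit and has distortion exactly K; uniqueness of weak derivatives then shows that no smaller
constant works (`hasDilatation_cantorSquare`). -/

/-! ### Real-linear maps of the plane and their distortion. -/

section LinearAlgebra

theorem Complex.clm_det_eq (A : ℂ →L[ℝ] ℂ) :
    A.det = (A 1).re * (A Complex.I).im - (A 1).im * (A Complex.I).re := by
  rw [ContinuousLinearMap.det, ← LinearMap.det_toMatrix Complex.basisOneI, Matrix.det_fin_two]
  simp [LinearMap.toMatrix_apply]
  ring

/-- The real-linear map `z ↦ α z + β z̄`. -/
noncomputable def Complex.wirtingerCLM (α β : ℂ) : ℂ →L[ℝ] ℂ :=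
  α • ContinuousLinearMap.id ℝ ℂ + β • (Complex.conjCLE : ℂ →L[ℝ] ℂ)

@[simp] theorem Complex.wirtingerCLM_apply (α β z : ℂ) :
    Complex.wirtingerCLM α β z = α * z + β * (starRingEnd ℂ) z := by
  simp [Complex.wirtingerCLM]

theorem Complex.wirtingerCLM_det (α β : ℂ) :
    (Complex.wirtingerCLM α β).det = ‖α‖ ^ 2 - ‖β‖ ^ 2 := by
  rw [Complex.clm_det_eq, Complex.sq_norm, Complex.sq_norm]
  simp [Complex.normSq_apply]
  ring

theorem Complex.wirtingerCLM_norm_le (α β : ℂ) :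
    ‖Complex.wirtingerCLM α β‖ ≤ ‖α‖ + ‖β‖ := by
  refine ContinuousLinearMap.opNorm_le_bound _ (by positivity) fun z => ?_
  rw [Complex.wirtingerCLM_apply]
  refine (norm_add_le _ _).trans ?_
  simp only [norm_mul, RCLike.norm_conj]
  linarith [add_mul ‖α‖ ‖β‖ ‖z‖]

theorem Complex.exists_eq_wirtingerCLM (A : ℂ →L[ℝ] ℂ) :
    ∃ α β : ℂ, A = Complex.wirtingerCLM α β ∧ ‖α‖ ≤ ‖A‖ ∧ ‖β‖ ≤ ‖A‖ := by
  have h1 : ‖A 1‖ ≤ ‖A‖ := by simpa using A.le_opNorm 1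
  have hI : ‖A Complex.I‖ ≤ ‖A‖ := by simpa using A.le_opNorm Complex.I
  refine ⟨(A 1 - Complex.I * A Complex.I) / 2, (A 1 + Complex.I * A Complex.I) / 2, ?_, ?_, ?_⟩
  · ext z
    rw [Complex.wirtingerCLM_apply]
    have hz : A z = z.re * A 1 + z.im * A Complex.I := by
      conv_lhs => rw [← Complex.re_add_im z]
      have e1 : (z.re : ℂ) = z.re • (1 : ℂ) := by simp
      have e2 : (z.im : ℂ) * Complex.I = z.im • Complex.I := by simp
      rw [e1, e2, map_add, map_smul, map_smul]
      simp
    have hc : (starRingEnd ℂ) z = z.re - z.im * Complex.I := by apply Complex.ext <;> simp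
    linear_combination hz + (A 1 - Complex.I * A Complex.I) / 2 * Complex.re_add_im z
      - (A 1 + Complex.I * A Complex.I) / 2 * hc + (z.im : ℂ) * A Complex.I * Complex.I_sq
  · rw [norm_div, Complex.norm_ofNat]
    have := norm_sub_le (A 1) (Complex.I * A Complex.I)
    rw [norm_mul, Complex.norm_I, one_mul] at this
    linarith
  · rw [norm_div, Complex.norm_ofNat]
    have := norm_add_le (A 1) (Complex.I * A Complex.I)
    rw [norm_mul, Complex.norm_I, one_mul] at this
    linarith

/-- The pointwise distortion inequality `|A|² ≤ K det A`. -/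
def HasDistortionLE (K : ℝ) (A : ℂ →L[ℝ] ℂ) : Prop := ‖A‖ ^ 2 ≤ K * A.det

/-- The determinant factors as (‖α‖ + ‖β‖)(‖α‖ - ‖β‖) and the norm is at most the first factor, so
comparing the two factors suffices. -/
theorem hasDistortionLE_wirtingerCLM {K : ℝ} {α β : ℂ} (h : ‖α‖ + ‖β‖ ≤ K * (‖α‖ - ‖β‖)) :
    HasDistortionLE K (Complex.wirtingerCLM α β) := by
  rw [HasDistortionLE, Complex.wirtingerCLM_det]
  have h1 := Complex.wirtingerCLM_norm_le α β
  calc ‖Complex.wirtingerCLM α β‖ ^ 2 ≤ (‖α‖ + ‖β‖) * (‖α‖ + ‖β‖) := by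
        rw [← sq]; gcongr
    _ ≤ (‖α‖ + ‖β‖) * (K * (‖α‖ - ‖β‖)) := by gcongr
    _ = _ := by ring

theorem hasDistortionLE_smul_id {K : ℝ} (hK : 1 ≤ K) (α : ℂ) :
    HasDistortionLE K (α • ContinuousLinearMap.id ℝ ℂ) := by
  have : α • ContinuousLinearMap.id ℝ ℂ = Complex.wirtingerCLM α 0 := by
    ext z; simp
  rw [this]
  apply hasDistortionLE_wirtingerCLM
  simpa using le_mul_of_one_le_left (norm_nonneg α) hK

theorem Complex.clm_det_neg (A : ℂ →L[ℝ] ℂ) : (-A).det = A.det := by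
  simp [Complex.clm_det_eq]

theorem HasDistortionLE.neg {K : ℝ} {A : ℂ →L[ℝ] ℂ} (h : HasDistortionLE K A) :
    HasDistortionLE K (-A) := by
  rwa [HasDistortionLE, norm_neg, Complex.clm_det_neg]

theorem continuous_clm_det : Continuous fun A : ℂ →L[ℝ] ℂ => A.det := by
  simp only [Complex.clm_det_eq]
  fun_prop

/-- Closedness lets the distortion bound pass from partial sums of derivatives to their pointwise
limit. -/
theorem isClosed_hasDistortionLE (K : ℝ) : IsClosed {A : ℂ →L[ℝ] ℂ | HasDistortionLE K A} :=
  isClosed_le (by fun_prop) (continuous_const.mul continuous_clm_det)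

/-- A small perturbation of a conformal linear map has small distortion. -/
theorem hasDistortionLE_smul_id_sub {K L : ℝ} (hK : 1 ≤ K) {α : ℂ} {B : ℂ →L[ℝ] ℂ} (hB : ‖B‖ ≤ L)
    (h : (K + 1) * L ≤ (K - 1) * (‖α‖ - L)) :
    HasDistortionLE K (α • ContinuousLinearMap.id ℝ ℂ - B) := by
  obtain ⟨a, c, rfl, ha, hc⟩ := Complex.exists_eq_wirtingerCLM B
  have : α • ContinuousLinearMap.id ℝ ℂ - Complex.wirtingerCLM a c
      = Complex.wirtingerCLM (α - a) (-c) := by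
    ext z; simp; ring
  rw [this]
  apply hasDistortionLE_wirtingerCLM
  -- Rearranged, the goal is (K + 1)‖c‖ ≤ (K - 1)‖α - a‖; both coefficients of B are at most L.
  rw [norm_neg]
  have h1 : ‖α‖ - L ≤ ‖α - a‖ := by linarith [norm_sub_norm_le α a]
  have h2 : (K + 1) * ‖c‖ ≤ (K + 1) * L := by gcongr; linarith
  have h3 : (K - 1) * (‖α‖ - L) ≤ (K - 1) * ‖α - a‖ := by
    apply mul_le_mul_of_nonneg_left h1; linarith
  linarith

end LinearAlgebra

/-! ### Weak derivatives of Lipschitz functions and of series. -/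

section WeakDerivative

theorem LipschitzWith.memLp_top_fderiv {C : NNReal} {f : ℂ → ℂ} (hf : LipschitzWith C f) :
    MemLp (fderiv ℝ f) ⊤ volume :=
  memLp_top_of_bound (measurable_fderiv ℝ f).aestronglyMeasurable C
    (ae_of_all _ fun _ => norm_fderiv_le_of_lipschitz ℝ hf)

theorem LipschitzWith.locallyIntegrable_fderiv {C : NNReal} {f : ℂ → ℂ} (hf : LipschitzWith C f) :
    LocallyIntegrable (fderiv ℝ f) :=
  hf.memLp_top_fderiv.locallyIntegrable le_top

theorem integrable_fderiv_smul {φ : ℂ → ℝ} (hφ : ContDiff ℝ ∞ φ) (hc : HasCompactSupport φ)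
    {f : ℂ → ℂ} (hf : Continuous f) (v : ℂ) : Integrable fun z => (fderiv ℝ φ z v) • f z := by
  have h1 : Continuous fun z => fderiv ℝ φ z v :=
    (hφ.continuous_fderiv (by simp)).clm_apply continuous_const
  refine (h1.smul hf).integrable_of_hasCompactSupport ?_
  exact (hc.fderiv_apply (𝕜 := ℝ) v).smul_right

theorem LocallyIntegrable.clm_apply_const {g : ℂ → (ℂ →L[ℝ] ℂ)} (hg : LocallyIntegrable g) (v : ℂ) :
    LocallyIntegrable fun z => g z v := by
  intro x
  obtain ⟨s, hs, hi⟩ := hg x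
  exact ⟨s, hs, (ContinuousLinearMap.apply ℝ ℂ v).integrable_comp hi⟩

theorem integrable_smul_clm_apply {φ : ℂ → ℝ} (hφ : ContDiff ℝ ∞ φ) (hc : HasCompactSupport φ)
    {g : ℂ → (ℂ →L[ℝ] ℂ)} (hg : LocallyIntegrable g) (v : ℂ) :
    Integrable fun z => φ z • g z v :=
  (LocallyIntegrable.clm_apply_const hg v).integrable_smul_left_of_hasCompactSupport
    hφ.continuous hc

theorem IsWeakDeriv.add {f f' : ℂ → ℂ} {g g' : ℂ → (ℂ →L[ℝ] ℂ)} (h : IsWeakDeriv f g)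
    (h' : IsWeakDeriv f' g') (hf : Continuous f) (hf' : Continuous f')
    (hg : LocallyIntegrable g) (hg' : LocallyIntegrable g') :
    IsWeakDeriv (fun z => f z + f' z) (fun z => g z + g' z) := by
  intro φ hφ hc v
  simp only [smul_add, add_apply]
  rw [integral_add (integrable_fderiv_smul hφ hc hf v) (integrable_fderiv_smul hφ hc hf' v),
    integral_add (integrable_smul_clm_apply hφ hc hg v) (integrable_smul_clm_apply hφ hc hg' v),
    h φ hφ hc v, h' φ hφ hc v, neg_add]

theorem IsWeakDeriv.neg {f : ℂ → ℂ} {g : ℂ → (ℂ →L[ℝ] ℂ)} (h : IsWeakDeriv f g) :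
    IsWeakDeriv (fun z => - f z) (fun z => - g z) := by
  intro φ hφ hc v
  simp only [smul_neg, neg_apply, integral_neg]
  rw [h φ hφ hc v]

theorem IsWeakDeriv.comp_sub_const {f : ℂ → ℂ} {g : ℂ → (ℂ →L[ℝ] ℂ)} (h : IsWeakDeriv f g) (a : ℂ) :
    IsWeakDeriv (fun z => f (z - a)) (fun z => g (z - a)) := by
  intro φ hφ hc v
  have h1 := h (fun z => φ (z + a)) (hφ.comp (contDiff_id.add contDiff_const))
    (hc.comp_homeomorph (Homeomorph.addRight a)) v
  simp only [fderiv_comp_add_right] at h1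
  rw [← integral_sub_right_eq_self _ a, ← integral_sub_right_eq_self (fun z => φ (z + a) • _) a]
    at h1
  simpa using h1

/-- Integration by parts for real Lipschitz functions, applied to the real and imaginary parts.
Rademacher's theorem identifies the line derivatives with the Fréchet derivative a.e. -/
theorem LipschitzWith.isWeakDeriv {C : NNReal} {f : ℂ → ℂ} (hf : LipschitzWith C f) :
    IsWeakDeriv f (fderiv ℝ f) := by
  intro φ hφ hc v
  have hi1 := integrable_fderiv_smul hφ hc hf.continuous v
  have hi2 := integrable_smul_clm_apply hφ hc hf.locallyIntegrable_fderiv v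
  obtain ⟨D, hD⟩ := hφ.lipschitzWith_of_hasCompactSupport hc (by simp)
  have key : ∀ L : ℂ →L[ℝ] ℝ, L (∫ z, (fderiv ℝ φ z v) • f z) =
      L (- ∫ z, φ z • fderiv ℝ f z v) := by
    intro L
    have hLf : LipschitzWith (‖L‖₊ * C) (fun z => L (f z)) := L.lipschitz.comp hf
    rw [map_neg, ← L.integral_comp_comm hi1, ← L.integral_comp_comm hi2]
    have h1 := hLf.integral_lineDeriv_mul_eq (μ := volume) hD hc v
    have h2 : ∀ x, lineDeriv ℝ φ x (-v) = - fderiv ℝ φ x v := fun x => by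
      rw [(hφ.differentiable (by simp) x).lineDeriv_eq_fderiv, map_neg]
    have h3 : ∀ᵐ x, lineDeriv ℝ (fun z => L (f z)) x v * φ x = L (φ x • fderiv ℝ f x v) := by
      filter_upwards [hf.ae_differentiableAt (μ := volume)] with x hx
      have : HasFDerivAt (fun z => L (f z)) (L.comp (fderiv ℝ f x)) x :=
        L.hasFDerivAt.comp x hx.hasFDerivAt
      rw [this.differentiableAt.lineDeriv_eq_fderiv, this.fderiv]
      rw [L.map_smul, smul_eq_mul, mul_comm]; rfl
    rw [integral_congr_ae h3] at h1
    rw [h1, ← integral_neg]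
    refine integral_congr_ae (ae_of_all _ fun x => ?_)
    simp only [h2, L.map_smul, smul_eq_mul]; ring
  apply Complex.ext
  · exact key Complex.reCLM
  · exact key Complex.imCLM

theorem isWeakDeriv_of_hasFDerivAt {f : ℂ → ℂ} {g : ℂ → (ℂ →L[ℝ] ℂ)}
    (h : ∀ z, HasFDerivAt f (g z) z) (hg : Continuous g) : IsWeakDeriv f g := by
  intro φ hφ hc v
  have hf : Continuous f := continuous_iff_continuousAt.2 fun z => (h z).continuousAt
  have hfd : fderiv ℝ f = g := funext fun z => (h z).fderiv
  have hi2 := integrable_smul_clm_apply hφ hc hg.locallyIntegrable v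
  have := integral_smul_fderiv_eq_neg_fderiv_smul_of_integrable (𝕜 := ℝ) (f := φ) (g := f)
    (μ := volume) (v := v) (integrable_fderiv_smul hφ hc hf v) (by rwa [hfd])
    ((hφ.continuous.smul hf).integrable_of_hasCompactSupport hc.smul_right)
    (fun x _ => hφ.differentiable (by simp) x) (fun x _ => (h x).differentiableAt)
  rw [hfd] at this
  rw [this, neg_neg]

/-- Needed for the minimality of the dilatation: a competing constant may come with another weak
derivative, which must agree a.e. with the computed one. -/
theorem IsWeakDeriv.ae_eq {f : ℂ → ℂ} {g g' : ℂ → (ℂ →L[ℝ] ℂ)} (h : IsWeakDeriv f g)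
    (h' : IsWeakDeriv f g') (hg : LocallyIntegrable g) (hg' : LocallyIntegrable g') :
    g =ᵐ[volume] g' := by
  have key : ∀ v : ℂ, ∀ᵐ z, g z v = g' z v := fun v => by
    refine ae_eq_of_integral_contDiff_smul_eq (LocallyIntegrable.clm_apply_const hg v)
      (LocallyIntegrable.clm_apply_const hg' v) fun φ hφ hc => ?_
    exact neg_injective ((h φ hφ hc v).symm.trans (h' φ hφ hc v))
  filter_upwards [key 1, key Complex.I] with z h1 hI
  refine ContinuousLinearMap.coe_injective ?_
  refine Complex.basisOneI.ext fun i => ?_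
  fin_cases i
  · simpa using h1
  · simpa using hI

theorem memLp_two_locallyIntegrable {g : ℂ → (ℂ →L[ℝ] ℂ)} (hg : MemLp g 2 volume) :
    LocallyIntegrable g := hg.locallyIntegrable (by norm_num)

/-- Weak derivatives may be computed term by term in series that converge absolutely in `W^{1,2}`
and uniformly. -/
theorem isWeakDeriv_tsum {δ : ℕ → ℂ → ℂ} {d : ℕ → ℂ → (ℂ →L[ℝ] ℂ)} {a : ℕ → ℝ}
    (hδ : ∀ m, Continuous (δ m)) (ha : Summable a) (hδa : ∀ m z, ‖δ m z‖ ≤ a m)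
    (hw : ∀ m, IsWeakDeriv (δ m) (d m)) (hd : ∀ m, MemLp (d m) 2 volume)
    (hsum : ∑' m, eLpNorm (d m) 2 volume ≠ ⊤) :
    ∃ g : ℂ → (ℂ →L[ℝ] ℂ), MemLp g 2 volume ∧ (∀ᵐ z, HasSum (fun m => d m z) (g z)) ∧
      IsWeakDeriv (fun z => ∑' m, δ m z) g := by
  have hLp : ∑' m, ‖(hd m).toLp (d m)‖ₑ ≠ ⊤ := by
    simpa [Lp.enorm_toLp] using hsum
  refine ⟨(∑' m, (hd m).toLp (d m) : Lp (ℂ →L[ℝ] ℂ) 2 volume), Lp.memLp _, ?_, ?_⟩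
  · filter_upwards [Lp.hasSum_coeFn_tsum hLp, ae_all_iff.2 fun m => (hd m).coeFn_toLp] with z hz hz'
    simpa only [hz'] using hz
  have hae : ∀ᵐ z, HasSum (fun m => d m z) ((∑' m, (hd m).toLp (d m) : Lp (ℂ →L[ℝ] ℂ) 2 volume) z) := by
    filter_upwards [Lp.hasSum_coeFn_tsum hLp, ae_all_iff.2 fun m => (hd m).coeFn_toLp] with z hz hz'
    simpa only [hz'] using hz
  intro φ hφ hc v
  have hL : ∀ z, ∑' m, (fderiv ℝ φ z v) • δ m z = (fderiv ℝ φ z v) • ∑' m, δ m z := fun z =>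
    (Summable.of_norm_bounded ha (fun m => hδa m z)).tsum_const_smul _
  have hi1 : Integrable fun z => fderiv ℝ φ z v := by
    have h1 : Continuous fun z => fderiv ℝ φ z v :=
      (hφ.continuous_fderiv (by simp)).clm_apply continuous_const
    exact h1.integrable_of_hasCompactSupport (hc.fderiv_apply (𝕜 := ℝ) v)
  have hS1 : HasSum (fun m => ∫ z, (fderiv ℝ φ z v) • δ m z)
      (∫ z, (fderiv ℝ φ z v) • ∑' m, δ m z) := by
    simp only [← hL]
    refine hasSum_integral_of_summable_integral_norm
      (fun m => integrable_fderiv_smul hφ hc (hδ m) v) ?_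
    refine Summable.of_nonneg_of_le (fun m => integral_nonneg fun z => norm_nonneg _) (fun m => ?_)
      (ha.mul_left (∫ z, ‖fderiv ℝ φ z v‖))
    rw [← integral_mul_const]
    refine integral_mono (integrable_fderiv_smul hφ hc (hδ m) v).norm (hi1.norm.mul_const _)
      fun z => ?_
    simp only [norm_smul]
    exact mul_le_mul_of_nonneg_left (hδa m z) (norm_nonneg _)
  have hi2 : ∀ m, Integrable fun z => φ z • d m z v := fun m =>
    integrable_smul_clm_apply hφ hc (memLp_two_locallyIntegrable (hd m)) v
  have hφ2 : MemLp φ 2 volume := hφ.continuous.memLp_of_hasCompactSupport hc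
  have hS2 : HasSum (fun m => ∫ z, φ z • d m z v)
      (∫ z, φ z • (∑' m, (hd m).toLp (d m) : Lp (ℂ →L[ℝ] ℂ) 2 volume) z v) := by
    have : ∫ z, φ z • (∑' m, (hd m).toLp (d m) : Lp (ℂ →L[ℝ] ℂ) 2 volume) z v
        = ∫ z, ∑' m, φ z • d m z v := by
      refine integral_congr_ae ?_
      filter_upwards [hae] with z hz
      exact (((ContinuousLinearMap.apply ℝ ℂ v).hasSum hz).const_smul (φ z)).tsum_eq.symm
    rw [this]
    refine hasSum_integral_of_summable_integral_norm hi2 ?_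
    -- By Hölder's inequality, L² summability of the derivatives dominates the pairings with the
    -- test function and justifies exchanging sum and integral.
    have hb : ∀ m, ∫⁻ z, ‖φ z • d m z v‖ₑ ≤
        eLpNorm φ 2 volume * ‖v‖ₑ * eLpNorm (d m) 2 volume := fun m => by
      have h1 : eLpNorm (φ • fun z => d m z v) 1 volume ≤
          eLpNorm φ 2 volume * eLpNorm (fun z => d m z v) 2 volume :=
        eLpNorm_smul_le_mul_eLpNorm
          ((ContinuousLinearMap.apply ℝ ℂ v).continuous.comp_aestronglyMeasurable
            (hd m).aestronglyMeasurable) hφ2.aestronglyMeasurable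
      rw [eLpNorm_one_eq_lintegral_enorm] at h1
      refine h1.trans ?_
      rw [mul_assoc]
      gcongr
      refine eLpNorm_le_nnreal_smul_eLpNorm_of_ae_le_mul (c := ‖v‖₊)
        (ae_of_all _ fun z => ?_) 2
      rw [mul_comm]
      exact (d m z).le_opNorm v
    have hfin : ∑' m, ∫⁻ z, ‖φ z • d m z v‖ₑ ≠ ⊤ := by
      refine ne_top_of_le_ne_top ?_ (ENNReal.tsum_le_tsum hb)
      rw [ENNReal.tsum_mul_left]
      exact ENNReal.mul_ne_top (ENNReal.mul_ne_top hφ2.eLpNorm_ne_top enorm_ne_top) hsum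
    have := ENNReal.summable_toReal hfin
    refine this.congr fun m => ?_
    rw [integral_norm_eq_lintegral_enorm (hi2 m).aestronglyMeasurable]
  have hS3 := hS2.neg
  simp only [← hw _ φ hφ hc v] at hS3
  exact hS1.unique hS3

end WeakDerivative

/-! ### Cantor-type maps between two sequences of scales. -/

section Scale

/-- Two sequences of radii `x`, `y` (source and target) for a Cantor-type construction: the disc of
radius `x n` contains a concentric disc of radius `t * x (n + 1)`, which contains two discs of radius
`x (n + 1)`; the moduli of the annuli on both sides differ by the factor `κ`. -/
structure IsScale (x y : ℕ → ℝ) (t κ : ℝ) : Prop where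
  pos_x : ∀ n, 0 < x n
  pos_y : ∀ n, 0 < y n
  four_le : 4 ≤ t
  pos_exp : 0 < κ
  x_succ : ∀ n, t * x (n + 1) ≤ x n
  y_succ : ∀ n, t * y (n + 1) ≤ y n
  ratio : ∀ n, t * y (n + 1) / y n = (t * x (n + 1) / x n) ^ κ

variable {x y : ℕ → ℝ} {t κ : ℝ}

/-- The inverse map is the same construction with the radii exchanged and the exponent inverted, so
every estimate on the source side also serves on the target side. -/
theorem IsScale.symm (h : IsScale x y t κ) : IsScale y x t κ⁻¹ where
  pos_x := h.pos_y
  pos_y := h.pos_x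
  four_le := h.four_le
  pos_exp := inv_pos.2 h.pos_exp
  x_succ := h.y_succ
  y_succ := h.x_succ
  ratio n := by
    have := h.four_le; have := h.pos_x n; have := h.pos_x (n + 1)
    rw [h.ratio n, ← Real.rpow_mul (by positivity), mul_inv_cancel₀ h.pos_exp.ne', Real.rpow_one]

theorem IsScale.x_le (h : IsScale x y t κ) (n : ℕ) : 4 * x (n + 1) ≤ x n :=
  (mul_le_mul_of_nonneg_right h.four_le (h.pos_x _).le).trans (h.x_succ n)

theorem IsScale.y_le (h : IsScale x y t κ) (n : ℕ) : 4 * y (n + 1) ≤ y n := h.symm.x_le n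

theorem IsScale.inner_pos (h : IsScale x y t κ) (n : ℕ) : 0 < t * x (n + 1) :=
  mul_pos (by linarith [h.four_le]) (h.pos_x _)

theorem IsScale.y_tendsto (h : IsScale x y t κ) (n : ℕ) :
    Tendsto (fun m => y (n + m)) atTop (𝓝 0) := by
  have hb : ∀ m, y (n + m) ≤ y n * (1 / 2) ^ m := by
    intro m
    induction m with
    | zero => simp
    | succ m ih =>
      have h1 := h.y_le (n + m)
      have h2 := h.pos_y (n + m + 1)
      rw [← add_assoc, pow_succ]
      linarith
  refine squeeze_zero (fun m => (h.pos_y _).le) hb ?_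
  simpa using (tendsto_pow_atTop_nhds_zero_of_lt_one (by norm_num : (0 : ℝ) ≤ 1 / 2)
    (by norm_num)).const_mul (y n)

/-- The radial factor of the stretch of level `n`. -/
noncomputable def radialGain (x y : ℕ → ℝ) (t κ : ℝ) (n : ℕ) (s : ℝ) : ℝ :=
  y n / x n * (max (t * x (n + 1) / x n) (min 1 (s / x n))) ^ (κ - 1)

/-- The radial stretch of level `n`: linear outside the disc of radius `x n` and inside the disc of
radius `t * x (n + 1)`, and a power of the radius in between. -/
noncomputable def radialStretch (x y : ℕ → ℝ) (t κ : ℝ) (n : ℕ) (u : ℂ) : ℂ :=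
  radialGain x y t κ n ‖u‖ • u

theorem IsScale.inner_ratio_le_one (h : IsScale x y t κ) (n : ℕ) : t * x (n + 1) / x n ≤ 1 :=
  (div_le_one (h.pos_x n)).2 (h.x_succ n)

theorem IsScale.inner_ratio_pos (h : IsScale x y t κ) (n : ℕ) : 0 < t * x (n + 1) / x n :=
  div_pos (h.inner_pos n) (h.pos_x n)

theorem IsScale.gain_pos (h : IsScale x y t κ) (n : ℕ) (s : ℝ) : 0 < radialGain x y t κ n s := by
  have := h.pos_x n; have := h.pos_y n
  exact mul_pos (by positivity) (Real.rpow_pos_of_pos (lt_max_of_lt_left (h.inner_ratio_pos n)) _)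

theorem IsScale.gain_of_ge (h : IsScale x y t κ) {n : ℕ} {s : ℝ} (hs : x n ≤ s) :
    radialGain x y t κ n s = y n / x n := by
  rw [radialGain, min_eq_left ((one_le_div (h.pos_x n)).2 hs), max_eq_right (h.inner_ratio_le_one n),
    Real.one_rpow, mul_one]

/-- The field `ratio` is exactly what makes the inner slope of level n equal to the outer slope of
level n + 1, so consecutive levels fit together. -/
theorem IsScale.gain_of_le (h : IsScale x y t κ) {n : ℕ} {s : ℝ} (hs : s ≤ t * x (n + 1)) :
    radialGain x y t κ n s = y (n + 1) / x (n + 1) := by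
  have h1 : s / x n ≤ t * x (n + 1) / x n := div_le_div_of_nonneg_right hs (h.pos_x n).le
  have h4 := h.four_le; have hx := h.pos_x n; have hx' := h.pos_x (n + 1); have hy := h.pos_y n
  rw [radialGain, max_eq_left ((min_le_right _ _).trans h1),
    Real.rpow_sub_one (h.inner_ratio_pos n).ne', ← h.ratio n]
  field_simp

theorem IsScale.gain_mid (h : IsScale x y t κ) {n : ℕ} {s : ℝ} (hs : t * x (n + 1) ≤ s)
    (hs' : s ≤ x n) : radialGain x y t κ n s = y n / x n * (s / x n) ^ (κ - 1) := by
  rw [radialGain, min_eq_right ((div_le_one (h.pos_x n)).2 hs'),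
    max_eq_right (div_le_div_of_nonneg_right hs (h.pos_x n).le)]

theorem IsScale.norm_stretch (h : IsScale x y t κ) (n : ℕ) (u : ℂ) :
    ‖radialStretch x y t κ n u‖ = radialGain x y t κ n ‖u‖ * ‖u‖ := by
  rw [radialStretch, norm_smul, Real.norm_of_nonneg (h.gain_pos n _).le]

theorem IsScale.stretch_of_ge (h : IsScale x y t κ) {n : ℕ} {u : ℂ} (hu : x n ≤ ‖u‖) :
    radialStretch x y t κ n u = (y n / x n) • u := by
  rw [radialStretch, h.gain_of_ge hu]

theorem IsScale.stretch_of_le (h : IsScale x y t κ) {n : ℕ} {u : ℂ} (hu : ‖u‖ ≤ t * x (n + 1)) :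
    radialStretch x y t κ n u = (y (n + 1) / x (n + 1)) • u := by
  rw [radialStretch, h.gain_of_le hu]

theorem IsScale.norm_stretch_mid (h : IsScale x y t κ) {n : ℕ} {u : ℂ} (hu : t * x (n + 1) ≤ ‖u‖)
    (hu' : ‖u‖ ≤ x n) : ‖radialStretch x y t κ n u‖ = y n * (‖u‖ / x n) ^ κ := by
  have hu0 : 0 < ‖u‖ := (h.inner_pos n).trans_le hu
  have hx := h.pos_x n
  rw [h.norm_stretch, h.gain_mid hu hu', Real.rpow_sub_one (by positivity)]
  field_simp

theorem IsScale.norm_stretch_le (h : IsScale x y t κ) {n : ℕ} {u : ℂ} (hu : ‖u‖ ≤ x n) :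
    ‖radialStretch x y t κ n u‖ ≤ y n := by
  have hx := h.pos_x n; have hx' := h.pos_x (n + 1); have hy' := h.pos_y (n + 1)
  rcases le_total ‖u‖ (t * x (n + 1)) with h1 | h1
  · rw [h.stretch_of_le h1, norm_smul, Real.norm_of_nonneg (by positivity)]
    refine le_trans ?_ (h.y_succ n)
    rw [div_mul_eq_mul_div, div_le_iff₀ hx']
    nlinarith
  · rw [h.norm_stretch_mid h1 hu]
    refine mul_le_of_le_one_right (h.pos_y n).le (Real.rpow_le_one (by positivity)
      ((div_le_one hx).2 hu) h.pos_exp.le)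

theorem IsScale.le_norm_stretch (h : IsScale x y t κ) {n : ℕ} {u : ℂ} (hu : t * x (n + 1) ≤ ‖u‖) :
    t * y (n + 1) ≤ ‖radialStretch x y t κ n u‖ := by
  have hx := h.pos_x n; have hy := h.pos_y n
  rcases le_total ‖u‖ (x n) with h1 | h1
  · rw [h.norm_stretch_mid hu h1, ← div_le_iff₀' hy, h.ratio n]
    exact Real.rpow_le_rpow (h.inner_ratio_pos n).le (div_le_div_of_nonneg_right hu hx.le)
      h.pos_exp.le
  · rw [h.stretch_of_ge h1, norm_smul, Real.norm_of_nonneg (by positivity)]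
    refine (h.y_succ n).trans ?_
    rw [div_mul_eq_mul_div, le_div_iff₀ hx]
    nlinarith

theorem IsScale.le_norm_stretch' (h : IsScale x y t κ) {n : ℕ} {u : ℂ} (hu : x n ≤ ‖u‖) :
    y n ≤ ‖radialStretch x y t κ n u‖ := by
  have hx := h.pos_x n; have hy := h.pos_y n
  rw [h.stretch_of_ge hu, norm_smul, Real.norm_of_nonneg (by positivity), div_mul_eq_mul_div,
    le_div_iff₀ hx]
  nlinarith

theorem IsScale.stretch_stretch (h : IsScale x y t κ) (n : ℕ) (u : ℂ) :
    radialStretch y x t κ⁻¹ n (radialStretch x y t κ n u) = u := by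
  have hx := h.pos_x n; have hy := h.pos_y n
  have hx' := h.pos_x (n + 1); have hy' := h.pos_y (n + 1)
  rcases le_total (x n) ‖u‖ with h1 | h1
  · rw [h.symm.stretch_of_ge (h.le_norm_stretch' h1), h.stretch_of_ge h1, smul_smul]
    field_simp
    simp
  rcases le_total ‖u‖ (t * x (n + 1)) with h2 | h2
  · rw [h.stretch_of_le h2, h.symm.stretch_of_le, smul_smul]
    · field_simp
      simp
    · rw [norm_smul, Real.norm_of_nonneg (by positivity), div_mul_eq_mul_div, div_le_iff₀ hx']
      nlinarith
  · have hu0 : 0 < ‖u‖ := (h.inner_pos n).trans_le h2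
    have hk := h.pos_exp
    rw [radialStretch, h.symm.gain_mid (h.le_norm_stretch h2) (h.norm_stretch_le h1),
      h.norm_stretch_mid h2 h1, radialStretch, h.gain_mid h2 h1, smul_smul,
      mul_div_cancel_left₀ _ hy.ne', ← Real.rpow_mul (by positivity)]
    have : κ * (κ⁻¹ - 1) = -(κ - 1) := by field_simp; ring
    rw [this, Real.rpow_neg (by positivity)]
    have : 0 < (‖u‖ / x n) ^ (κ - 1) := by positivity
    field_simp
    simp

/-- The deviation of the stretch of level `n` from its linear outer part. -/
noncomputable def radialBump (x y : ℕ → ℝ) (t κ : ℝ) (n : ℕ) (u : ℂ) : ℂ :=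
  radialStretch x y t κ n u - (y n / x n) • u

theorem IsScale.bump_of_ge (h : IsScale x y t κ) {n : ℕ} {u : ℂ} (hu : x n ≤ ‖u‖) :
    radialBump x y t κ n u = 0 := by
  rw [radialBump, h.stretch_of_ge hu, sub_self]

theorem IsScale.norm_bump_le (h : IsScale x y t κ) (n : ℕ) (u : ℂ) :
    ‖radialBump x y t κ n u‖ ≤ 2 * y n := by
  have hx := h.pos_x n; have hy := h.pos_y n
  rcases le_total (x n) ‖u‖ with h1 | h1
  · rw [h.bump_of_ge h1, norm_zero]; positivity
  · refine (norm_sub_le _ _).trans ?_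
    have h2 := h.norm_stretch_le h1
    have h3 : ‖(y n / x n) • u‖ ≤ y n := by
      rw [norm_smul, Real.norm_of_nonneg (by positivity), div_mul_eq_mul_div, div_le_iff₀ hx]
      nlinarith
    linarith

theorem IsScale.continuous_bump (h : IsScale x y t κ) (n : ℕ) :
    Continuous (radialBump x y t κ n) := by
  have hg : Continuous fun u : ℂ => radialGain x y t κ n ‖u‖ := by
    unfold radialGain
    refine Continuous.mul continuous_const (Continuous.rpow_const (by fun_prop) fun u => Or.inl ?_)
    exact (lt_max_of_lt_left (h.inner_ratio_pos n)).ne'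
  unfold radialBump radialStretch
  fun_prop

theorem radialBump_neg (n : ℕ) (u : ℂ) : radialBump x y t κ n (-u) = - radialBump x y t κ n u := by
  simp only [radialBump, radialStretch, norm_neg, smul_neg]
  ring

/-- The bumps of level `n + m` placed at the centres of the discs of that level inside a disc of
level `n`. -/
noncomputable def bumpLayer (x y : ℕ → ℝ) (t κ : ℝ) : ℕ → ℕ → ℂ → ℂ
  | 0, n, u => radialBump x y t κ n u
  | m + 1, n, u => bumpLayer x y t κ m (n + 1) (u - ((t * x (n + 1) / 2 : ℝ) : ℂ)) +
      bumpLayer x y t κ m (n + 1) (u + ((t * x (n + 1) / 2 : ℝ) : ℂ))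

/-- Passing one level down doubles the number of bumps but shrinks the target radius by at least 4,
so the triangle inequality still leaves a factor 1/2. -/
theorem IsScale.norm_layer_le (h : IsScale x y t κ) (m n : ℕ) (u : ℂ) :
    ‖bumpLayer x y t κ m n u‖ ≤ 2 * y n * (1 / 2) ^ m := by
  induction m generalizing n u with
  | zero => simpa [bumpLayer] using h.norm_bump_le n u
  | succ m ih =>
    rw [bumpLayer]
    refine (norm_add_le_of_le (ih _ _) (ih _ _)).trans ?_
    have h1 := h.y_le n
    have h2 : (0 : ℝ) < (1 / 2) ^ m := by positivity
    rw [pow_succ]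
    nlinarith

theorem IsScale.continuous_layer (h : IsScale x y t κ) (m n : ℕ) :
    Continuous (bumpLayer x y t κ m n) := by
  induction m generalizing n with
  | zero => exact h.continuous_bump n
  | succ m ih =>
    exact ((ih (n + 1)).comp (continuous_id.sub continuous_const)).add
      ((ih (n + 1)).comp (continuous_id.add continuous_const))

theorem bumpLayer_neg (m n : ℕ) (u : ℂ) :
    bumpLayer x y t κ m n (-u) = - bumpLayer x y t κ m n u := by
  induction m generalizing n u with
  | zero => exact radialBump_neg n u
  | succ m ih =>
    simp only [bumpLayer]
    rw [show -u - ((t * x (n + 1) / 2 : ℝ) : ℂ) = -(u + ((t * x (n + 1) / 2 : ℝ) : ℂ)) by ring,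
      show -u + ((t * x (n + 1) / 2 : ℝ) : ℂ) = -(u - ((t * x (n + 1) / 2 : ℝ) : ℂ)) by ring,
      ih, ih]
    ring

theorem IsScale.norm_center (h : IsScale x y t κ) (n : ℕ) :
    ‖((t * x (n + 1) / 2 : ℝ) : ℂ)‖ = t * x (n + 1) / 2 := by
  rw [Complex.norm_real, Real.norm_of_nonneg (by linarith [h.inner_pos n])]

theorem IsScale.le_norm_sub_center (h : IsScale x y t κ) {n : ℕ} {u : ℂ}
    (hu : t * x (n + 1) ≤ ‖u‖) :
    x (n + 1) ≤ ‖u - ((t * x (n + 1) / 2 : ℝ) : ℂ)‖ ∧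
      x (n + 1) ≤ ‖u + ((t * x (n + 1) / 2 : ℝ) : ℂ)‖ := by
  have h1 := norm_sub_norm_le u ((t * x (n + 1) / 2 : ℝ) : ℂ)
  have h2 := norm_sub_norm_le u (-((t * x (n + 1) / 2 : ℝ) : ℂ))
  rw [norm_neg, sub_neg_eq_add] at h2
  rw [h.norm_center] at h1 h2
  have := mul_le_mul_of_nonneg_right h.four_le (h.pos_x (n + 1)).le
  have := h.pos_x (n + 1)
  constructor <;> linarith

/-- A point close to one of the two centres is far from the other one. -/
theorem IsScale.le_norm_add_center (h : IsScale x y t κ) {n : ℕ} {u : ℂ}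
    (hu : ‖u - ((t * x (n + 1) / 2 : ℝ) : ℂ)‖ ≤ x (n + 1)) :
    x (n + 1) < ‖u + ((t * x (n + 1) / 2 : ℝ) : ℂ)‖ ∧ ‖u‖ < t * x (n + 1) := by
  have h1 := norm_sub_norm_le ((t * x (n + 1) : ℝ) : ℂ) (-(u - ((t * x (n + 1) / 2 : ℝ) : ℂ)))
  have h2 := norm_add_le (u - ((t * x (n + 1) / 2 : ℝ) : ℂ)) ((t * x (n + 1) / 2 : ℝ) : ℂ)
  have h3 : ((t * x (n + 1) : ℝ) : ℂ) - -(u - ((t * x (n + 1) / 2 : ℝ) : ℂ))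
      = u + ((t * x (n + 1) / 2 : ℝ) : ℂ) := by push_cast; ring
  rw [sub_add_cancel, h.norm_center] at h2
  rw [h3, norm_neg, Complex.norm_real, Real.norm_of_nonneg (h.inner_pos n).le] at h1
  have := mul_le_mul_of_nonneg_right h.four_le (h.pos_x (n + 1)).le
  have := h.pos_x (n + 1)
  constructor <;> linarith

theorem IsScale.layer_of_ge (h : IsScale x y t κ) (m : ℕ) {n : ℕ} {u : ℂ} (hu : x n ≤ ‖u‖) :
    bumpLayer x y t κ m n u = 0 := by
  induction m generalizing n u with
  | zero => exact h.bump_of_ge hu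
  | succ m ih =>
    have h1 := h.le_norm_sub_center ((h.x_succ n).trans hu)
    rw [bumpLayer, ih h1.1, ih h1.2, add_zero]

/-- The sum of all bumps of level at least `n` inside a disc of level `n`. -/
noncomputable def bumpSum (x y : ℕ → ℝ) (t κ : ℝ) (n : ℕ) (u : ℂ) : ℂ :=
  ∑' m, bumpLayer x y t κ m n u

theorem IsScale.summable_layer_bound (_ : IsScale x y t κ) (n : ℕ) :
    Summable fun m : ℕ => 2 * y n * (1 / 2 : ℝ) ^ m :=
  (summable_geometric_of_lt_one (by norm_num) (by norm_num)).mul_left _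

theorem IsScale.summable_layer (h : IsScale x y t κ) (n : ℕ) (u : ℂ) :
    Summable fun m => bumpLayer x y t κ m n u :=
  .of_norm_bounded (h.summable_layer_bound n) fun m => h.norm_layer_le m n u

theorem IsScale.norm_bumpSum_le (h : IsScale x y t κ) (n : ℕ) (u : ℂ) :
    ‖bumpSum x y t κ n u‖ ≤ 4 * y n := by
  have h1 := tsum_of_norm_bounded ((hasSum_geometric_of_lt_one (by norm_num : (0 : ℝ) ≤ 1 / 2)
    (by norm_num)).mul_left (2 * y n)) fun m => h.norm_layer_le m n u
  refine h1.trans (le_of_eq ?_)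
  norm_num
  ring

theorem IsScale.continuous_bumpSum (h : IsScale x y t κ) (n : ℕ) :
    Continuous (bumpSum x y t κ n) :=
  continuous_tsum (fun m => h.continuous_layer m n) (h.summable_layer_bound n)
    fun m u => h.norm_layer_le m n u

theorem IsScale.bumpSum_of_ge (h : IsScale x y t κ) {n : ℕ} {u : ℂ} (hu : x n ≤ ‖u‖) :
    bumpSum x y t κ n u = 0 := by
  simp [bumpSum, h.layer_of_ge _ hu]

theorem bumpSum_neg (n : ℕ) (u : ℂ) : bumpSum x y t κ n (-u) = - bumpSum x y t κ n u := by
  simp only [bumpSum, bumpLayer_neg, tsum_neg]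

theorem IsScale.bumpSum_eq (h : IsScale x y t κ) (n : ℕ) (u : ℂ) :
    bumpSum x y t κ n u = radialBump x y t κ n u +
      (bumpSum x y t κ (n + 1) (u - ((t * x (n + 1) / 2 : ℝ) : ℂ)) +
        bumpSum x y t κ (n + 1) (u + ((t * x (n + 1) / 2 : ℝ) : ℂ))) := by
  rw [bumpSum, (h.summable_layer n u).tsum_eq_zero_add]
  simp only [bumpLayer]
  rw [(h.summable_layer _ _).tsum_add (h.summable_layer _ _)]
  rfl

/-- The map of level `n` with stretches on all levels; it maps the Cantor set of level `n` built
from `x` to that built from `y`. -/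
noncomputable def cantorMap (x y : ℕ → ℝ) (t κ : ℝ) (n : ℕ) (u : ℂ) : ℂ :=
  (y n / x n) • u + bumpSum x y t κ n u

theorem IsScale.cantorMap_eq (h : IsScale x y t κ) (n : ℕ) (u : ℂ) :
    cantorMap x y t κ n u = radialStretch x y t κ n u +
      (bumpSum x y t κ (n + 1) (u - ((t * x (n + 1) / 2 : ℝ) : ℂ)) +
        bumpSum x y t κ (n + 1) (u + ((t * x (n + 1) / 2 : ℝ) : ℂ))) := by
  rw [cantorMap, h.bumpSum_eq, radialBump]
  ring

theorem IsScale.cantorMap_outer (h : IsScale x y t κ) {n : ℕ} {u : ℂ}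
    (h1 : x (n + 1) ≤ ‖u - ((t * x (n + 1) / 2 : ℝ) : ℂ)‖)
    (h2 : x (n + 1) ≤ ‖u + ((t * x (n + 1) / 2 : ℝ) : ℂ)‖) :
    cantorMap x y t κ n u = radialStretch x y t κ n u := by
  rw [h.cantorMap_eq, h.bumpSum_of_ge h1, h.bumpSum_of_ge h2, add_zero, add_zero]

theorem cantorMap_neg (n : ℕ) (u : ℂ) : cantorMap x y t κ n (-u) = - cantorMap x y t κ n u := by
  rw [cantorMap, cantorMap, bumpSum_neg, smul_neg]
  ring

/-- Self-similarity, the source of all inductions over levels. Near one centre the bumps around the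
other vanish and the stretch is linear with the outer slope of the next level. -/
theorem IsScale.cantorMap_inner (h : IsScale x y t κ) {n : ℕ} {u : ℂ} (hu : ‖u‖ ≤ x (n + 1)) :
    cantorMap x y t κ n (((t * x (n + 1) / 2 : ℝ) : ℂ) + u) =
      ((t * y (n + 1) / 2 : ℝ) : ℂ) + cantorMap x y t κ (n + 1) u := by
  have hx := h.pos_x (n + 1)
  set v := ((t * x (n + 1) / 2 : ℝ) : ℂ) + u with hv
  have hvu : v - ((t * x (n + 1) / 2 : ℝ) : ℂ) = u := by rw [hv]; ring
  have h1 := h.le_norm_add_center (u := v) (by rwa [hvu])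
  rw [h.cantorMap_eq, hvu, h.bumpSum_of_ge h1.1.le, h.stretch_of_le h1.2.le, cantorMap, hv, add_zero,
    smul_add, add_assoc]
  congr 1
  rw [Complex.real_smul, ← Complex.ofReal_mul]
  congr 1
  field_simp

theorem IsScale.cantorMap_inner_neg (h : IsScale x y t κ) {n : ℕ} {u : ℂ} (hu : ‖u‖ ≤ x (n + 1)) :
    cantorMap x y t κ n (-((t * x (n + 1) / 2 : ℝ) : ℂ) + u) =
      -((t * y (n + 1) / 2 : ℝ) : ℂ) + cantorMap x y t κ (n + 1) u := by
  have := h.cantorMap_inner (n := n) (u := -u) (by rwa [norm_neg])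
  rw [cantorMap_neg] at this
  rw [show -((t * x (n + 1) / 2 : ℝ) : ℂ) + u = -(((t * x (n + 1) / 2 : ℝ) : ℂ) + -u) by ring,
    cantorMap_neg, this]
  ring

/-- Case distinction for the position of a point relative to the two discs of the next level. -/
theorem center_cases (x : ℕ → ℝ) (t : ℝ) (n : ℕ) (u : ℂ) :
    (x (n + 1) ≤ ‖u - ((t * x (n + 1) / 2 : ℝ) : ℂ)‖ ∧
      x (n + 1) ≤ ‖u + ((t * x (n + 1) / 2 : ℝ) : ℂ)‖) ∨
    (∃ v, ‖v‖ ≤ x (n + 1) ∧ u = ((t * x (n + 1) / 2 : ℝ) : ℂ) + v) ∨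
    (∃ v, ‖v‖ ≤ x (n + 1) ∧ u = -((t * x (n + 1) / 2 : ℝ) : ℂ) + v) := by
  rcases le_total (x (n + 1)) ‖u - ((t * x (n + 1) / 2 : ℝ) : ℂ)‖ with h1 | h1
  · rcases le_total (x (n + 1)) ‖u + ((t * x (n + 1) / 2 : ℝ) : ℂ)‖ with h2 | h2
    · exact Or.inl ⟨h1, h2⟩
    · exact Or.inr (Or.inr ⟨_, h2, by ring⟩)
  · exact Or.inr (Or.inl ⟨_, h1, by ring⟩)

theorem IsScale.norm_cantorMap_le (h : IsScale x y t κ) {n : ℕ} {u : ℂ} (hu : ‖u‖ ≤ x n) :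
    ‖cantorMap x y t κ n u‖ ≤ y n := by
  -- Descend m levels by self-similarity and use the crude bound on the bump sum only at the bottom.
  -- The error term then lives at level n + m and disappears as m → ∞.
  have key : ∀ (m n : ℕ) (u : ℂ), ‖u‖ ≤ x n → ‖cantorMap x y t κ n u‖ ≤ y n + 4 * y (n + m) := by
    intro m
    induction m with
    | zero =>
      intro n u hu
      have hx := h.pos_x n; have hy := h.pos_y n
      refine norm_add_le_of_le ?_ (h.norm_bumpSum_le n u)
      rw [norm_smul, Real.norm_of_nonneg (by positivity), div_mul_eq_mul_div, div_le_iff₀ hx]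
      nlinarith
    | succ m ih =>
      intro n u hu
      have hy := h.pos_y (n + (m + 1))
      have hy1 := h.y_succ n
      have hy2 := mul_le_mul_of_nonneg_right h.four_le (h.pos_y (n + 1)).le
      have hy3 := h.pos_y (n + 1)
      rcases center_cases x t n u with ⟨h1, h2⟩ | ⟨v, hv, rfl⟩ | ⟨v, hv, rfl⟩
      · rw [h.cantorMap_outer h1 h2]
        linarith [h.norm_stretch_le hu]
      · rw [h.cantorMap_inner hv]
        have := norm_add_le_of_le (h.symm.norm_center n).le (ih (n + 1) v hv)
        rw [show n + 1 + m = n + (m + 1) by ring] at this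
        linarith
      · rw [h.cantorMap_inner_neg hv]
        have := norm_add_le_of_le ((norm_neg _).trans (h.symm.norm_center n)).le (ih (n + 1) v hv)
        rw [show n + 1 + m = n + (m + 1) by ring] at this
        linarith
  have hlim : Tendsto (fun m => y n + 4 * y (n + m)) atTop (𝓝 (y n + 4 * 0)) :=
    ((h.y_tendsto n).const_mul 4).const_add _
  rw [mul_zero, add_zero] at hlim
  exact ge_of_tendsto' hlim fun m => key m n u hu

/-- Outside the two discs of the next level both maps are single stretches inverse to each other;
inside, the question moves one level down. After m descents point and image share a disc of radius
`x (n + m)`, which tends to 0. -/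
theorem IsScale.cantorMap_cantorMap (h : IsScale x y t κ) (n : ℕ) (u : ℂ) :
    cantorMap y x t κ⁻¹ n (cantorMap x y t κ n u) = u := by
  have key : ∀ (m n : ℕ) (u : ℂ), ‖u‖ ≤ x n →
      ‖cantorMap y x t κ⁻¹ n (cantorMap x y t κ n u) - u‖ ≤ 2 * x (n + m) := by
    intro m
    induction m with
    | zero =>
      intro n u hu
      have := norm_sub_le_of_le (h.symm.norm_cantorMap_le (h.norm_cantorMap_le hu)) hu
      simpa [two_mul] using this
    | succ m ih =>
      intro n u hu
      rw [show n + (m + 1) = n + 1 + m by ring]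
      rcases center_cases x t n u with ⟨h1, h2⟩ | ⟨v, hv, rfl⟩ | ⟨v, hv, rfl⟩
      · have hx := h.pos_x (n + 1 + m)
        -- The image also avoids the two smaller target discs, so the inverse map acts on it by its
        -- stretch alone.
        have h3 : y (n + 1) ≤ ‖radialStretch x y t κ n u - ((t * y (n + 1) / 2 : ℝ) : ℂ)‖ ∧
            y (n + 1) ≤ ‖radialStretch x y t κ n u + ((t * y (n + 1) / 2 : ℝ) : ℂ)‖ := by
          rcases le_total ‖u‖ (t * x (n + 1)) with h4 | h4
          · have hx' := h.pos_x (n + 1)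
            have hy' := h.pos_y (n + 1)
            have h5 : ((t * y (n + 1) / 2 : ℝ) : ℂ) =
                (y (n + 1) / x (n + 1)) • ((t * x (n + 1) / 2 : ℝ) : ℂ) := by
              rw [Complex.real_smul, ← Complex.ofReal_mul]
              congr 1
              field_simp
            rw [h.stretch_of_le h4, h5, ← smul_sub, ← smul_add, norm_smul, norm_smul,
              Real.norm_of_nonneg (by positivity), div_mul_eq_mul_div, div_mul_eq_mul_div,
              le_div_iff₀ hx', le_div_iff₀ hx']
            constructor <;> nlinarith
          · exact h.symm.le_norm_sub_center (h.le_norm_stretch h4)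
        rw [h.cantorMap_outer h1 h2, h.symm.cantorMap_outer h3.1 h3.2, h.stretch_stretch, sub_self,
          norm_zero]
        linarith
      · rw [h.cantorMap_inner hv, h.symm.cantorMap_inner (h.norm_cantorMap_le hv),
          add_sub_add_left_eq_sub]
        exact ih _ _ hv
      · rw [h.cantorMap_inner_neg hv, h.symm.cantorMap_inner_neg (h.norm_cantorMap_le hv),
          add_sub_add_left_eq_sub]
        exact ih _ _ hv
  rcases le_total ‖u‖ (x n) with hu | hu
  · have hlim := (h.symm.y_tendsto n).const_mul 2
    rw [mul_zero] at hlim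
    have := ge_of_tendsto' hlim fun m => key m n u hu
    exact sub_eq_zero.1 (norm_le_zero_iff.1 this)
  · have h1 := h.le_norm_stretch' hu
    have hx := h.pos_x n; have hy := h.pos_y n
    rw [h.stretch_of_ge hu] at h1
    rw [cantorMap, cantorMap, h.bumpSum_of_ge hu, add_zero, h.symm.bumpSum_of_ge h1, add_zero,
      smul_smul]
    field_simp
    simp

theorem IsScale.bijective_cantorMap (h : IsScale x y t κ) (n : ℕ) :
    Function.Bijective (cantorMap x y t κ n) := by
  refine Function.bijective_iff_has_inverse.2 ⟨cantorMap y x t κ⁻¹ n, h.cantorMap_cantorMap n, ?_⟩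
  have := h.symm.cantorMap_cantorMap n
  rwa [inv_inv] at this

/-- The union of the discs of level `n + l` inside the disc of level `n`. -/
def cantorLevel (x : ℕ → ℝ) (t : ℝ) : ℕ → ℕ → Set ℂ
  | 0, n => Metric.closedBall 0 (x n)
  | l + 1, n => {u | ∃ v ∈ cantorLevel x t l (n + 1), u = ((t * x (n + 1) / 2 : ℝ) : ℂ) + v ∨
      u = -((t * x (n + 1) / 2 : ℝ) : ℂ) + v}

theorem IsScale.cantorLevel_subset (h : IsScale x y t κ) (l n : ℕ) :
    cantorLevel x t l n ⊆ Metric.closedBall 0 (x n) := by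
  induction l generalizing n with
  | zero => exact subset_rfl
  | succ l ih =>
    rintro u ⟨v, hv, hu⟩
    have hv := mem_closedBall_zero_iff.1 (ih _ hv)
    rw [mem_closedBall_zero_iff]
    have h1 := h.norm_center n
    have h2 := h.x_succ n
    have h3 := mul_le_mul_of_nonneg_right h.four_le (h.pos_x (n + 1)).le
    have h4 := h.pos_x (n + 1)
    rcases hu with rfl | rfl
    · linarith [norm_add_le_of_le h1.le hv]
    · linarith [norm_add_le_of_le ((norm_neg _).trans h1).le hv]

theorem IsScale.mapsTo_cantorLevel (h : IsScale x y t κ) (l n : ℕ) :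
    Set.MapsTo (cantorMap x y t κ n) (cantorLevel x t l n) (cantorLevel y t l n) := by
  induction l generalizing n with
  | zero =>
    intro u hu
    exact mem_closedBall_zero_iff.2 (h.norm_cantorMap_le (mem_closedBall_zero_iff.1 hu))
  | succ l ih =>
    rintro u ⟨v, hv, hu⟩
    have hv' := mem_closedBall_zero_iff.1 (h.cantorLevel_subset _ _ hv)
    refine ⟨_, ih (n + 1) hv, ?_⟩
    rcases hu with rfl | rfl
    · exact Or.inl (h.cantorMap_inner hv')
    · exact Or.inr (h.cantorMap_inner_neg hv')

theorem exists_cover_cantorLevel (x : ℕ → ℝ) (t : ℝ) (l n : ℕ) :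
    ∃ s : Finset ℂ, s.card ≤ 2 ^ l ∧
      cantorLevel x t l n ⊆ ⋃ a ∈ s, Metric.closedBall a (x (n + l)) := by
  induction l generalizing n with
  | zero => exact ⟨{0}, by simp, by simp [cantorLevel]⟩
  | succ l ih =>
    obtain ⟨s, hs, hc⟩ := ih (n + 1)
    refine ⟨s.image (fun a => ((t * x (n + 1) / 2 : ℝ) : ℂ) + a) ∪
      s.image (fun a => -((t * x (n + 1) / 2 : ℝ) : ℂ) + a), ?_, ?_⟩
    · refine (Finset.card_union_le _ _).trans ?_
      have h1 := Finset.card_image_le (s := s) (f := fun a => ((t * x (n + 1) / 2 : ℝ) : ℂ) + a)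
      have h2 := Finset.card_image_le (s := s) (f := fun a => -((t * x (n + 1) / 2 : ℝ) : ℂ) + a)
      rw [pow_succ]
      omega
    · rintro u ⟨v, hv, hu⟩
      obtain ⟨a, ha, hva⟩ := Set.mem_iUnion₂.1 (hc hv)
      rw [show n + 1 + l = n + (l + 1) by ring] at hva
      rw [Set.mem_iUnion₂]
      rcases hu with rfl | rfl
      · refine ⟨_, Finset.mem_union_left _ (Finset.mem_image_of_mem _ ha), ?_⟩
        simpa using hva
      · refine ⟨_, Finset.mem_union_right _ (Finset.mem_image_of_mem _ ha), ?_⟩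
        simpa using hva

end Scale

/-! ### Derivatives, L² bounds and distortion of the bumps. -/

section ScaleDerivative

variable {x y : ℕ → ℝ} {t κ : ℝ}

theorem IsScale.gain_le (h : IsScale x y t κ) (hκ : κ ≤ 1) (n : ℕ) (s : ℝ) :
    radialGain x y t κ n s ≤ y (n + 1) / x (n + 1) := by
  have hx := h.pos_x n; have hy := h.pos_y n
  rw [← h.gain_of_le le_rfl, radialGain, radialGain]
  refine mul_le_mul_of_nonneg_left ?_ (by positivity)
  rw [max_eq_left (min_le_right _ _)]
  exact Real.rpow_le_rpow_of_nonpos (h.inner_ratio_pos n) (le_max_left _ _) (by linarith)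

theorem IsScale.slope_le (h : IsScale x y t κ) (hκ : κ ≤ 1) (n : ℕ) :
    y n / x n ≤ y (n + 1) / x (n + 1) :=
  h.gain_of_ge (le_refl (x n)) ▸ h.gain_le hκ n (x n)

theorem IsScale.gain_antitone (h : IsScale x y t κ) (hκ : κ ≤ 1) (n : ℕ) :
    Antitone (radialGain x y t κ n) := by
  intro s s' hs
  have hx := h.pos_x n; have hy := h.pos_y n
  refine mul_le_mul_of_nonneg_left ?_ (by positivity)
  refine Real.rpow_le_rpow_of_nonpos (lt_max_of_lt_left (h.inner_ratio_pos n)) ?_ (by linarith)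
  gcongr

/-- Clamping `s` and dividing by `s` gives a nonincreasing function; this is the form free of
division. -/
theorem clamp_mul_le {q s s' : ℝ} (hq : 0 < q) (hs : 0 < s) (hss : s ≤ s') :
    max q (min 1 s') * s ≤ max q (min 1 s) * s' := by
  rcases max_cases q (min 1 s') with ⟨h1, h2⟩ | ⟨h1, h2⟩ <;>
  rcases max_cases q (min 1 s) with ⟨h3, h4⟩ | ⟨h3, h4⟩ <;>
  rcases min_cases 1 s' with ⟨h5, h6⟩ | ⟨h5, h6⟩ <;>
  rcases min_cases 1 s with ⟨h7, h8⟩ | ⟨h7, h8⟩ <;>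
  rw [h1, h3] <;> simp only [h5, h7] at * <;> nlinarith

/-- Up to a positive constant the image radius is c ^ (κ - 1) * s = (s / c) ^ (1 - κ) * s ^ κ, where
c is the clamped relative radius; both s and s / c are nondecreasing. -/
theorem IsScale.gain_mul_le (h : IsScale x y t κ) (hκ : κ ≤ 1) (n : ℕ) {s s' : ℝ} (hs : 0 ≤ s)
    (hss : s ≤ s') : radialGain x y t κ n s * s ≤ radialGain x y t κ n s' * s' := by
  rcases hs.eq_or_lt with rfl | hs
  · rw [mul_zero]
    exact mul_nonneg (h.gain_pos n _).le hss
  have hx := h.pos_x n; have hy := h.pos_y n; have hk := h.pos_exp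
  have hs' : 0 < s' := hs.trans_le hss
  unfold radialGain
  set c := max (t * x (n + 1) / x n) (min 1 (s / x n)) with hc
  set c' := max (t * x (n + 1) / x n) (min 1 (s' / x n)) with hc'
  have c0 : 0 < c := lt_max_of_lt_left (h.inner_ratio_pos n)
  have c0' : 0 < c' := lt_max_of_lt_left (h.inner_ratio_pos n)
  have h1 : c' * s ≤ c * s' := by
    have := clamp_mul_le (h.inner_ratio_pos n) (div_pos hs hx)
      (div_le_div_of_nonneg_right hss hx.le)
    rw [← hc, ← hc', mul_div_assoc', mul_div_assoc'] at this
    exact (div_le_div_iff_of_pos_right hx).1 this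
  have h2 : (c' * s) ^ (1 - κ) * s ^ κ ≤ (c * s') ^ (1 - κ) * s' ^ κ := by
    have : 0 ≤ 1 - κ := by linarith
    gcongr
  rw [Real.mul_rpow c0'.le hs.le, Real.mul_rpow c0.le hs'.le, mul_assoc, mul_assoc,
    ← Real.rpow_add hs, ← Real.rpow_add hs', sub_add_cancel, Real.rpow_one, Real.rpow_one] at h2
  have e : κ - 1 = -(1 - κ) := by ring
  rw [e, Real.rpow_neg c0.le, Real.rpow_neg c0'.le, mul_assoc, mul_assoc]
  refine mul_le_mul_of_nonneg_left ?_ (by positivity)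
  have p1 : 0 < c ^ (1 - κ) := by positivity
  have p2 : 0 < c' ^ (1 - κ) := by positivity
  rw [inv_mul_eq_div, inv_mul_eq_div, div_le_div_iff₀ p1 p2]
  linarith

/-- With g the gain and ‖u‖ ≤ ‖v‖, the difference is g(u)(u - v) + (g(u) - g(v)) v. Since g
decreases and s g(s) increases, the second term is at most g(u)(‖v‖ - ‖u‖), hence no larger than the
bound for the first. -/
theorem IsScale.norm_stretch_sub_le (h : IsScale x y t κ) (hκ : κ ≤ 1) (n : ℕ) (u v : ℂ) :
    ‖radialStretch x y t κ n u - radialStretch x y t κ n v‖ ≤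
      2 * (y (n + 1) / x (n + 1)) * ‖u - v‖ := by
  wlog huv : ‖u‖ ≤ ‖v‖ generalizing u v
  · rw [norm_sub_rev, norm_sub_rev u v]
    exact this v u (le_of_not_ge huv)
  have e : radialStretch x y t κ n u - radialStretch x y t κ n v =
      radialGain x y t κ n ‖u‖ • (u - v) +
        (radialGain x y t κ n ‖u‖ - radialGain x y t κ n ‖v‖) • v := by
    simp only [radialStretch, smul_sub, sub_smul]
    abel
  have h1 := h.gain_antitone hκ n huv
  have h2 := h.gain_mul_le hκ n (norm_nonneg u) huv
  have h3 := h.gain_le hκ n ‖u‖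
  have h4 := (h.gain_pos n ‖u‖).le
  have h5 : ‖v‖ - ‖u‖ ≤ ‖u - v‖ := by rw [norm_sub_rev]; exact norm_sub_norm_le v u
  rw [e]
  refine (norm_add_le _ _).trans ?_
  rw [norm_smul, norm_smul, Real.norm_of_nonneg h4, Real.norm_of_nonneg (by linarith)]
  have h6 : radialGain x y t κ n ‖u‖ * (‖v‖ - ‖u‖) ≤ radialGain x y t κ n ‖u‖ * ‖u - v‖ := by
    gcongr
  have h7 : radialGain x y t κ n ‖u‖ * ‖u - v‖ ≤ y (n + 1) / x (n + 1) * ‖u - v‖ := by gcongr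
  linarith

theorem IsScale.lipschitz_bump (h : IsScale x y t κ) (hκ : κ ≤ 1) (n : ℕ) :
    LipschitzWith (3 * (y (n + 1) / x (n + 1))).toNNReal (radialBump x y t κ n) := by
  have hx := h.pos_x n; have hy := h.pos_y n
  have hx' := h.pos_x (n + 1); have hy' := h.pos_y (n + 1)
  refine LipschitzWith.of_dist_le_mul fun u v => ?_
  rw [Real.coe_toNNReal _ (by positivity), dist_eq_norm, dist_eq_norm]
  have e : radialBump x y t κ n u - radialBump x y t κ n v =
      (radialStretch x y t κ n u - radialStretch x y t κ n v) - (y n / x n) • (u - v) := by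
    simp only [radialBump, smul_sub]
    abel
  rw [e]
  refine (norm_sub_le _ _).trans ?_
  rw [norm_smul, Real.norm_of_nonneg (by positivity)]
  have h1 := h.norm_stretch_sub_le hκ n u v
  have h2 := mul_le_mul_of_nonneg_right (h.slope_le hκ n) (norm_nonneg (u - v))
  linarith

/-- Powers of the squared norm keep the computation algebraic in `u` and its conjugate. With p = (κ
- 1)/2 this is the radial stretch, and the moduli of the two coefficients have sum l and difference
l κ for l = ‖u‖ ^ (κ - 1). -/
theorem hasFDerivAt_normSq_rpow_smul (p : ℝ) {u : ℂ} (hu : u ≠ 0) :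
    HasFDerivAt (fun u : ℂ => ((‖u‖ ^ 2) ^ p) • u)
      (Complex.wirtingerCLM (((‖u‖ ^ 2) ^ p * (1 + p) : ℝ))
        (((‖u‖ ^ 2) ^ p * p : ℝ) * (u ^ 2 / (‖u‖ ^ 2 : ℝ)))) u := by
  have hu2 : (0 : ℝ) < ‖u‖ ^ 2 := by positivity
  have h1 := (((hasStrictFDerivAt_norm_sq u).hasFDerivAt.rpow_const (p := p)
    (Or.inl hu2.ne'))).smul (hasFDerivAt_id u)
  refine h1.congr_fderiv ?_
  ext z
  rw [Complex.wirtingerCLM_apply]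
  have e1 : ((‖u‖ ^ 2 : ℝ) : ℂ) = u * (starRingEnd ℂ) u := by
    rw [Complex.mul_conj, Complex.normSq_eq_norm_sq]
  have e2 : ((inner ℝ u z : ℝ) : ℂ) = ((starRingEnd ℂ) u * z + u * (starRingEnd ℂ) z) / 2 := by
    rw [Complex.inner]
    apply Complex.ext <;> simp <;> ring
  have e3 : (‖u‖ ^ 2) ^ (p - 1) = (‖u‖ ^ 2) ^ p / (‖u‖ ^ 2) := Real.rpow_sub_one hu2.ne' p
  have hc : (starRingEnd ℂ) u ≠ 0 := by simpa using hu
  simp only [add_apply, smul_apply, ContinuousLinearMap.smulRight_apply,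
    ContinuousLinearMap.id_apply, innerSL_apply_apply, id, e3, Complex.real_smul, smul_eq_mul,
    nsmul_eq_mul]
  push_cast at e1 ⊢
  rw [e1, e2]
  field_simp
  ring

theorem norm_coeffs_normSq_rpow_smul {p : ℝ} (hp : p ≤ 0) (hp' : -1 < p) {u : ℂ} (hu : u ≠ 0) :
    ‖(((‖u‖ ^ 2) ^ p * (1 + p) : ℝ) : ℂ)‖ = (‖u‖ ^ 2) ^ p * (1 + p) ∧
    ‖(((‖u‖ ^ 2) ^ p * p : ℝ) : ℂ) * (u ^ 2 / (‖u‖ ^ 2 : ℝ))‖ = -((‖u‖ ^ 2) ^ p * p) := by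
  have hu2 : (0 : ℝ) < ‖u‖ ^ 2 := by positivity
  have hpp : 0 < (‖u‖ ^ 2) ^ p := by positivity
  constructor
  · rw [Complex.norm_real, Real.norm_of_nonneg]
    exact mul_nonneg hpp.le (by linarith)
  · rw [norm_mul, norm_div, norm_pow, Complex.norm_real, Complex.norm_real,
      Real.norm_of_nonneg hu2.le, div_self hu2.ne', mul_one, Real.norm_of_nonpos]
    exact mul_nonpos_of_nonneg_of_nonpos hpp.le hp

/-- The derivative of a bump. -/
noncomputable def bumpDeriv (x y : ℕ → ℝ) (t κ : ℝ) (n : ℕ) : ℂ → (ℂ →L[ℝ] ℂ) :=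
  fderiv ℝ (radialBump x y t κ n)

theorem IsScale.bumpDeriv_of_gt (h : IsScale x y t κ) {n : ℕ} {u : ℂ} (hu : x n < ‖u‖) :
    bumpDeriv x y t κ n u = 0 := by
  have : radialBump x y t κ n =ᶠ[𝓝 u] fun _ => 0 := by
    filter_upwards [continuous_norm.continuousAt.eventually (lt_mem_nhds hu)] with v hv
    exact h.bump_of_ge (le_of_lt hv)
  rw [bumpDeriv, this.fderiv_eq, fderiv_const_apply]

theorem IsScale.bumpDeriv_of_lt (h : IsScale x y t κ) {n : ℕ} {u : ℂ} (hu : ‖u‖ < t * x (n + 1)) :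
    (y n / x n) • ContinuousLinearMap.id ℝ ℂ + bumpDeriv x y t κ n u =
      (y (n + 1) / x (n + 1)) • ContinuousLinearMap.id ℝ ℂ := by
  have : radialBump x y t κ n =ᶠ[𝓝 u]
      fun v => ((y (n + 1) / x (n + 1)) • ContinuousLinearMap.id ℝ ℂ -
        (y n / x n) • ContinuousLinearMap.id ℝ ℂ) v := by
    filter_upwards [continuous_norm.continuousAt.eventually (gt_mem_nhds hu)] with v hv
    rw [radialBump, h.stretch_of_le (le_of_lt hv)]
    rfl
  rw [bumpDeriv, this.fderiv_eq, ContinuousLinearMap.fderiv]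
  abel

theorem IsScale.bumpDeriv_mid (h : IsScale x y t κ) {n : ℕ} {u : ℂ} (hu : t * x (n + 1) < ‖u‖)
    (hu' : ‖u‖ < x n) :
    (y n / x n) • ContinuousLinearMap.id ℝ ℂ + bumpDeriv x y t κ n u =
      (y n / x n * (x n) ^ (1 - κ)) • (Complex.wirtingerCLM
        (((‖u‖ ^ 2) ^ ((κ - 1) / 2) * (1 + (κ - 1) / 2) : ℝ))
        (((‖u‖ ^ 2) ^ ((κ - 1) / 2) * ((κ - 1) / 2) : ℝ) * (u ^ 2 / (‖u‖ ^ 2 : ℝ)))) := by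
  have hx := h.pos_x n
  have hu0 : u ≠ 0 := norm_pos_iff.1 ((h.inner_pos n).trans hu)
  have : radialBump x y t κ n =ᶠ[𝓝 u] fun v => (y n / x n * (x n) ^ (1 - κ)) •
      (((‖v‖ ^ 2) ^ ((κ - 1) / 2)) • v) - (y n / x n) • v := by
    filter_upwards [continuous_norm.continuousAt.eventually (gt_mem_nhds hu'),
      continuous_norm.continuousAt.eventually (lt_mem_nhds hu)] with v hv hv'
    rw [radialBump, radialStretch, h.gain_mid (le_of_lt hv') (le_of_lt hv), smul_smul,
      ← Real.rpow_natCast, ← Real.rpow_mul (norm_nonneg v), Real.div_rpow (norm_nonneg v) hx.le,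
      show 1 - κ = -(κ - 1) by ring, Real.rpow_neg hx.le,
      show ((2 : ℕ) : ℝ) * ((κ - 1) / 2) = κ - 1 by push_cast; ring]
    congr 2
    ring
  have hd := ((hasFDerivAt_normSq_rpow_smul ((κ - 1) / 2) hu0).const_smul
    (y n / x n * (x n) ^ (1 - κ))).sub ((hasFDerivAt_id u).const_smul (y n / x n))
  rw [bumpDeriv, this.fderiv_eq]
  refine (congrArg _ (HasFDerivAt.fderiv hd)).trans ?_
  abel

theorem HasDistortionLE.smul {K : ℝ} {A : ℂ →L[ℝ] ℂ} (h : HasDistortionLE K A) (c : ℝ) :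
    HasDistortionLE K (c • A) := by
  unfold HasDistortionLE at *
  have hd : (c • A).det = c ^ 2 * A.det := by
    simp [Complex.clm_det_eq]
    ring
  rw [norm_smul, hd, mul_pow, Real.norm_eq_abs, sq_abs]
  nlinarith [sq_nonneg c]

theorem IsScale.hasDistortionLE_bumpDeriv (h : IsScale x y t κ) (hκ : κ ≤ 1) {n : ℕ} {u : ℂ}
    (h1 : ‖u‖ ≠ x n) (h2 : ‖u‖ ≠ t * x (n + 1)) :
    HasDistortionLE κ⁻¹ ((y n / x n) • ContinuousLinearMap.id ℝ ℂ + bumpDeriv x y t κ n u) := by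
  have hk := h.pos_exp
  have hid : ∀ c : ℝ, HasDistortionLE κ⁻¹ (c • ContinuousLinearMap.id ℝ ℂ) := fun c => by
    have := hasDistortionLE_smul_id ((one_le_inv₀ hk).2 hκ) 1
    rw [one_smul] at this
    exact this.smul c
  rcases lt_or_gt_of_ne h2 with h3 | h3
  · rw [h.bumpDeriv_of_lt h3]
    exact hid _
  rcases lt_or_gt_of_ne h1 with h4 | h4
  · rw [h.bumpDeriv_mid h3 h4]
    have hu0 : u ≠ 0 := norm_pos_iff.1 ((h.inner_pos n).trans h3)
    refine HasDistortionLE.smul (hasDistortionLE_wirtingerCLM ?_) _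
    have := norm_coeffs_normSq_rpow_smul (p := (κ - 1) / 2) (by linarith) (by linarith) hu0
    rw [this.1, this.2]
    apply le_of_eq
    field_simp
    ring
  · rw [h.bumpDeriv_of_gt h4, add_zero]
    exact hid _

/-- After removing a positive scalar, the tangential vector `I * u` is stretched by l while the
determinant is l² κ, so the distortion quotient is at least κ⁻¹. -/
theorem IsScale.inv_le_of_hasDistortionLE (h : IsScale x y t κ) (hκ : κ ≤ 1) {n : ℕ} {u : ℂ}
    (h1 : ‖u‖ < x n) (h2 : t * x (n + 1) < ‖u‖) {K' : ℝ}
    (hd : HasDistortionLE K'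
      ((y n / x n) • ContinuousLinearMap.id ℝ ℂ + bumpDeriv x y t κ n u)) : κ⁻¹ ≤ K' := by
  have hk := h.pos_exp
  have hx := h.pos_x n; have hy := h.pos_y n
  have hu0 : u ≠ 0 := norm_pos_iff.1 ((h.inner_pos n).trans h2)
  rw [h.bumpDeriv_mid h2 h1] at hd
  set c := y n / x n * (x n) ^ (1 - κ) with hc
  have c0 : 0 < c := by positivity
  have hd := hd.smul c⁻¹
  rw [smul_smul, inv_mul_cancel₀ c0.ne', one_smul] at hd
  set A := Complex.wirtingerCLM
        (((‖u‖ ^ 2) ^ ((κ - 1) / 2) * (1 + (κ - 1) / 2) : ℝ))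
        (((‖u‖ ^ 2) ^ ((κ - 1) / 2) * ((κ - 1) / 2) : ℝ) * (u ^ 2 / (‖u‖ ^ 2 : ℝ))) with hA
  have hcf := norm_coeffs_normSq_rpow_smul (p := (κ - 1) / 2) (by linarith) (by linarith) hu0
  have hdet : A.det = ((‖u‖ ^ 2) ^ ((κ - 1) / 2)) ^ 2 * κ := by
    rw [hA, Complex.wirtingerCLM_det, hcf.1, hcf.2]
    ring
  set l := (‖u‖ ^ 2) ^ ((κ - 1) / 2) with hl
  have l0 : 0 < l := by positivity
  have hval : A (Complex.I * u) = (l : ℂ) * (Complex.I * u) := by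
    have e1 : ((‖u‖ ^ 2 : ℝ) : ℂ) = u * (starRingEnd ℂ) u := by
      rw [Complex.mul_conj, Complex.normSq_eq_norm_sq]
    have hcu : (starRingEnd ℂ) u ≠ 0 := by simpa using hu0
    rw [hA, Complex.wirtingerCLM_apply, e1, map_mul, Complex.conj_I]
    push_cast
    field_simp
    ring
  have hnorm : l ≤ ‖A‖ := by
    have := A.le_opNorm (Complex.I * u)
    rw [hval, norm_mul, Complex.norm_real, Real.norm_of_nonneg l0.le] at this
    exact le_of_mul_le_mul_right this (by simpa using hu0)
  rw [HasDistortionLE, hdet] at hd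
  have h3 : l ^ 2 ≤ ‖A‖ ^ 2 := by gcongr
  have h4 : l ^ 2 * 1 ≤ l ^ 2 * (K' * κ) := by linarith
  have h5 := le_of_mul_le_mul_left h4 (by positivity)
  rwa [inv_le_iff_one_le_mul₀ hk]

/-- The derivative of a layer of bumps. -/
noncomputable def layerDeriv (x y : ℕ → ℝ) (t κ : ℝ) : ℕ → ℕ → ℂ → (ℂ →L[ℝ] ℂ)
  | 0, n, u => bumpDeriv x y t κ n u
  | m + 1, n, u => layerDeriv x y t κ m (n + 1) (u - ((t * x (n + 1) / 2 : ℝ) : ℂ)) +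
      layerDeriv x y t κ m (n + 1) (u + ((t * x (n + 1) / 2 : ℝ) : ℂ))

theorem layerDeriv_succ (m n : ℕ) : layerDeriv x y t κ (m + 1) n =
    fun u => layerDeriv x y t κ m (n + 1) (u - ((t * x (n + 1) / 2 : ℝ) : ℂ)) +
      layerDeriv x y t κ m (n + 1) (u + ((t * x (n + 1) / 2 : ℝ) : ℂ)) := rfl

theorem IsScale.layerDeriv_of_gt (h : IsScale x y t κ) (m : ℕ) {n : ℕ} {u : ℂ} (hu : x n < ‖u‖) :
    layerDeriv x y t κ m n u = 0 := by
  induction m generalizing n u with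
  | zero => exact h.bumpDeriv_of_gt hu
  | succ m ih =>
    have h1 := norm_sub_norm_le u ((t * x (n + 1) / 2 : ℝ) : ℂ)
    have h2 := norm_sub_norm_le u (-((t * x (n + 1) / 2 : ℝ) : ℂ))
    rw [norm_neg, sub_neg_eq_add] at h2
    rw [h.norm_center] at h1 h2
    have h3 := mul_le_mul_of_nonneg_right h.four_le (h.pos_x (n + 1)).le
    have h4 := h.pos_x (n + 1)
    have h5 := h.x_succ n
    rw [layerDeriv, ih (by linarith), ih (by linarith), add_zero]

theorem MemLp.comp_sub_const_clm {g : ℂ → (ℂ →L[ℝ] ℂ)} (hg : MemLp g 2 volume) (a : ℂ) :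
    MemLp (fun z => g (z - a)) 2 volume :=
  hg.comp_measurePreserving (measurePreserving_sub_right volume a)

theorem eLpNorm_comp_sub_const_clm {g : ℂ → (ℂ →L[ℝ] ℂ)} (hg : MemLp g 2 volume) (a : ℂ) :
    eLpNorm (fun z => g (z - a)) 2 volume = eLpNorm g 2 volume :=
  eLpNorm_comp_measurePreserving hg.aestronglyMeasurable (measurePreserving_sub_right volume a)

theorem memLp_two_add {E : Type*} [NormedAddCommGroup E] {μ : Measure ℂ} {f g : ℂ → E}
    (hf : MemLp f 2 μ) (hg : MemLp g 2 μ) : MemLp (fun z => f z + g z) 2 μ := hf.add hg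

theorem locallyIntegrable_add {E : Type*} [NormedAddCommGroup E] {f g : ℂ → E}
    (hf : LocallyIntegrable f) (hg : LocallyIntegrable g) :
    LocallyIntegrable fun z => f z + g z := hf.add hg

theorem eLpNorm_two_add_le {E : Type*} [NormedAddCommGroup E] {f g : ℂ → E}
    (hf : MemLp f 2 volume) (hg : MemLp g 2 volume) :
    eLpNorm (fun z => f z + g z) 2 volume ≤ eLpNorm f 2 volume + eLpNorm g 2 volume :=
  eLpNorm_add_le hf.aestronglyMeasurable hg.aestronglyMeasurable one_le_two

theorem eLpNorm_two_le_of_norm_le {E : Type*} [NormedAddCommGroup E] {g : ℂ → E} {C r : ℝ}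
    (_hC : 0 ≤ C) (hr : 0 ≤ r) (hb : ∀ u, ‖g u‖ ≤ C) (hs : ∀ u, r < ‖u‖ → g u = 0) :
    eLpNorm g 2 volume ≤ ENNReal.ofReal (√Real.pi * (C * r)) := by
  have hs : Function.support g ⊆ Metric.closedBall 0 r := fun u hu => by
    rw [mem_closedBall_zero_iff]
    by_contra hcon
    exact hu (hs u (lt_of_not_ge hcon))
  rw [← eLpNorm_restrict_eq_of_support_subset hs]
  refine (eLpNorm_le_of_ae_bound (ae_of_all _ hb)).trans (le_of_eq ?_)
  rw [Measure.restrict_apply_univ, Complex.volume_closedBall]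
  have e : ENNReal.ofReal r ^ 2 * (NNReal.pi : ℝ≥0∞) = ENNReal.ofReal ((√Real.pi * r) ^ 2) := by
    rw [mul_pow, Real.sq_sqrt Real.pi_pos.le, ENNReal.ofReal_mul Real.pi_pos.le,
      ENNReal.ofReal_pow hr, mul_comm]
    congr 1
    rw [ENNReal.ofReal, ← NNReal.coe_real_pi, Real.toNNReal_coe]
  have e2 : (2 : ℝ≥0∞).toReal⁻¹ = 1 / 2 := by simp
  rw [e, e2, ENNReal.ofReal_rpow_of_nonneg (by positivity) (by positivity),
    ← Real.sqrt_eq_rpow, Real.sqrt_sq (by positivity), ← ENNReal.ofReal_mul (by positivity)]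
  congr 1
  ring

theorem IsScale.eLpNorm_bumpDeriv_le (h : IsScale x y t κ) (hκ : κ ≤ 1) (n : ℕ) :
    eLpNorm (bumpDeriv x y t κ n) 2 volume ≤
      ENNReal.ofReal (√Real.pi * (3 * (y (n + 1) / x (n + 1)) * x n)) := by
  have hx := h.pos_x n
  have hx' := h.pos_x (n + 1); have hy' := h.pos_y (n + 1)
  refine eLpNorm_two_le_of_norm_le (by positivity) hx.le (fun u => ?_)
    fun u hu => h.bumpDeriv_of_gt hu
  have := norm_fderiv_le_of_lipschitz ℝ (x₀ := u) (h.lipschitz_bump hκ n)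
  rwa [Real.coe_toNNReal _ (by positivity)] at this

theorem IsScale.memLp_bumpDeriv (h : IsScale x y t κ) (hκ : κ ≤ 1) (n : ℕ) :
    MemLp (bumpDeriv x y t κ n) 2 volume :=
  ⟨(measurable_fderiv ℝ _).aestronglyMeasurable,
    (h.eLpNorm_bumpDeriv_le hκ n).trans_lt ENNReal.ofReal_lt_top⟩

theorem IsScale.memLp_layerDeriv (h : IsScale x y t κ) (hκ : κ ≤ 1) (m n : ℕ) :
    MemLp (layerDeriv x y t κ m n) 2 volume := by
  induction m generalizing n with
  | zero => exact h.memLp_bumpDeriv hκ n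
  | succ m ih =>
    have h1 := MemLp.comp_sub_const_clm (ih (n + 1)) ((t * x (n + 1) / 2 : ℝ) : ℂ)
    have h2 := MemLp.comp_sub_const_clm (ih (n + 1)) (-((t * x (n + 1) / 2 : ℝ) : ℂ))
    simp only [sub_neg_eq_add] at h2
    rw [layerDeriv_succ]
    exact memLp_two_add h1 h2

/-- The L² norm of a bump derivative is controlled by slope times radius. By `hdecay` this product
drops by a factor 4 per level, and the two translated copies cost a factor 2. -/
theorem IsScale.eLpNorm_layerDeriv_le (h : IsScale x y t κ) (hκ : κ ≤ 1)
    (hdecay : ∀ n, 4 * (y (n + 2) / x (n + 2) * x (n + 1)) ≤ y (n + 1) / x (n + 1) * x n)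
    (m n : ℕ) :
    eLpNorm (layerDeriv x y t κ m n) 2 volume ≤
      ENNReal.ofReal (√Real.pi * (3 * (y (n + 1) / x (n + 1)) * x n) * (1 / 2) ^ m) := by
  induction m generalizing n with
  | zero => simpa [layerDeriv] using h.eLpNorm_bumpDeriv_le hκ n
  | succ m ih =>
    have hx := h.pos_x (n + 1)
    have hx' := h.pos_x (n + 1 + 1); have hy' := h.pos_y (n + 1 + 1)
    have hm := h.memLp_layerDeriv hκ m (n + 1)
    have h1 := eLpNorm_comp_sub_const_clm hm ((t * x (n + 1) / 2 : ℝ) : ℂ)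
    have h2 := eLpNorm_comp_sub_const_clm hm (-((t * x (n + 1) / 2 : ℝ) : ℂ))
    have hm1 := MemLp.comp_sub_const_clm hm ((t * x (n + 1) / 2 : ℝ) : ℂ)
    have hm2 := MemLp.comp_sub_const_clm hm (-((t * x (n + 1) / 2 : ℝ) : ℂ))
    simp only [sub_neg_eq_add] at h2 hm2
    have h3 := eLpNorm_two_add_le hm1 hm2
    rw [h1, h2] at h3
    rw [layerDeriv_succ]
    refine h3.trans ((add_le_add (ih (n + 1)) (ih (n + 1))).trans ?_)
    rw [← ENNReal.ofReal_add (by positivity) (by positivity)]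
    apply ENNReal.ofReal_le_ofReal
    have h4 := mul_le_mul_of_nonneg_left (hdecay n)
      (by positivity : 0 ≤ 3 * √Real.pi * (1 / 2) ^ m)
    rw [pow_succ]
    linarith

theorem IsScale.isWeakDeriv_layer (h : IsScale x y t κ) (hκ : κ ≤ 1) (m n : ℕ) :
    IsWeakDeriv (bumpLayer x y t κ m n) (layerDeriv x y t κ m n) := by
  induction m generalizing n with
  | zero => exact (h.lipschitz_bump hκ n).isWeakDeriv
  | succ m ih =>
    have hm := h.memLp_layerDeriv hκ m (n + 1)
    have hc := h.continuous_layer m (n + 1)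
    have h1 := (ih (n + 1)).comp_sub_const ((t * x (n + 1) / 2 : ℝ) : ℂ)
    have h2 := (ih (n + 1)).comp_sub_const (-((t * x (n + 1) / 2 : ℝ) : ℂ))
    have hm1 := MemLp.comp_sub_const_clm hm ((t * x (n + 1) / 2 : ℝ) : ℂ)
    have hm2 := MemLp.comp_sub_const_clm hm (-((t * x (n + 1) / 2 : ℝ) : ℂ))
    simp only [sub_neg_eq_add] at h2 hm2
    exact h1.add h2 (hc.comp (continuous_id.sub continuous_const))
      (hc.comp (continuous_id.add continuous_const))
      (memLp_two_locallyIntegrable hm1) (memLp_two_locallyIntegrable hm2)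

theorem ae_norm_sub_ne (a : ℂ) (r : ℝ) : ∀ᵐ u : ℂ, ‖u - a‖ ≠ r := by
  have h1 : (volume : Measure ℂ) (Metric.sphere a r) = 0 := by
    rcases eq_or_ne r 0 with rfl | hr
    · simp
    · exact Measure.addHaar_sphere_of_ne_zero _ _ hr
  filter_upwards [measure_eq_zero_iff_ae_notMem.1 h1] with u hu
  simpa [dist_eq_norm] using hu

theorem ae_comp_sub_const {p : ℂ → Prop} (hp : ∀ᵐ u, p u) (a : ℂ) : ∀ᵐ u, p (u - a) :=
  (measurePreserving_sub_right volume a).quasiMeasurePreserving.ae hp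

/-- Off null circles at most one branch is active. Near a centre the bump of level n only raises the
slope to that of level n + 1, which reproduces the same sum one level down with one term fewer;
elsewhere only the bump of level n contributes. -/
theorem IsScale.ae_hasDistortionLE_sum (h : IsScale x y t κ) (hκ : κ ≤ 1) (N n : ℕ) :
    ∀ᵐ u, HasDistortionLE κ⁻¹ ((y n / x n) • ContinuousLinearMap.id ℝ ℂ +
      ∑ m ∈ Finset.range N, layerDeriv x y t κ m n u) := by
  induction N generalizing n with
  | zero =>
    refine ae_of_all _ fun u => ?_
    have := hasDistortionLE_smul_id ((one_le_inv₀ h.pos_exp).2 hκ) 1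
    rw [one_smul] at this
    simpa using this.smul (y n / x n)
  | succ N ih =>
    have i1 := ae_comp_sub_const (ih (n + 1)) ((t * x (n + 1) / 2 : ℝ) : ℂ)
    have i2 := ae_comp_sub_const (ih (n + 1)) (-((t * x (n + 1) / 2 : ℝ) : ℂ))
    simp only [sub_neg_eq_add] at i2
    have j1 := ae_norm_sub_ne ((t * x (n + 1) / 2 : ℝ) : ℂ) (x (n + 1))
    have j2 := ae_norm_sub_ne (-((t * x (n + 1) / 2 : ℝ) : ℂ)) (x (n + 1))
    simp only [sub_neg_eq_add] at j2
    have j3 := ae_norm_sub_ne 0 (x n)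
    have j4 := ae_norm_sub_ne 0 (t * x (n + 1))
    simp only [sub_zero] at j3 j4
    filter_upwards [i1, i2, j1, j2, j3, j4] with u i1 i2 j1 j2 j3 j4
    have hz : ∀ v : ℂ, x (n + 1) < ‖v‖ →
        ∑ m ∈ Finset.range N, layerDeriv x y t κ m (n + 1) v = 0 := fun v hv =>
      Finset.sum_eq_zero fun m _ => h.layerDeriv_of_gt m hv
    rw [Finset.sum_range_succ']
    simp only [layerDeriv]
    rw [Finset.sum_add_distrib, add_comm (Finset.sum _ _ + _), ← add_assoc]
    rcases lt_or_gt_of_ne j1 with k1 | k1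
    · have k2 := h.le_norm_add_center k1.le
      rwa [h.bumpDeriv_of_lt k2.2, hz _ k2.1, add_zero]
    rcases lt_or_gt_of_ne j2 with k2 | k2
    · have k3 := h.le_norm_add_center (n := n) (u := -u) (by
        rw [← norm_neg, neg_sub, sub_neg_eq_add, add_comm]; exact k2.le)
      rw [norm_neg] at k3
      rw [h.bumpDeriv_of_lt k3.2, hz _ k1, zero_add]
      exact i2
    · rw [hz _ k1, hz _ k2, add_zero, add_zero]
      exact h.hasDistortionLE_bumpDeriv hκ j3 j4

/-- The last clause isolates the annulus where only the first bump contributes; there the derivative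
is explicit and bounds the dilatation from below. -/
theorem IsScale.exists_weakDeriv_bumpSum (h : IsScale x y t κ) (hκ : κ ≤ 1)
    (hdecay : ∀ n, 4 * (y (n + 2) / x (n + 2) * x (n + 1)) ≤ y (n + 1) / x (n + 1) * x n)
    (n : ℕ) : ∃ G : ℂ → (ℂ →L[ℝ] ℂ), MemLp G 2 volume ∧ IsWeakDeriv (bumpSum x y t κ n) G ∧
      (∀ᵐ u, HasDistortionLE κ⁻¹ ((y n / x n) • ContinuousLinearMap.id ℝ ℂ + G u)) ∧
      (∀ᵐ u, x n < ‖u‖ → G u = 0) ∧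
      (∀ᵐ u, ‖u‖ < x n → t * x (n + 1) < ‖u‖ → ∀ K' : ℝ, HasDistortionLE K'
        ((y n / x n) • ContinuousLinearMap.id ℝ ℂ + G u) → κ⁻¹ ≤ K') := by
  have hsum : ∑' m, eLpNorm (layerDeriv x y t κ m n) 2 volume ≠ ⊤ := by
    refine ne_top_of_le_ne_top ?_ (ENNReal.tsum_le_tsum fun m => h.eLpNorm_layerDeriv_le hκ hdecay m n)
    have hx := h.pos_x n; have hx' := h.pos_x (n + 1); have hy' := h.pos_y (n + 1)
    have hs : Summable fun m : ℕ =>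
        √Real.pi * (3 * (y (n + 1) / x (n + 1)) * x n) * (1 / 2 : ℝ) ^ m :=
      (summable_geometric_of_lt_one (by norm_num) (by norm_num)).mul_left _
    rw [← ENNReal.ofReal_tsum_of_nonneg (fun m => by positivity) hs]
    exact ENNReal.ofReal_ne_top
  obtain ⟨G, hG, hae, hw⟩ := isWeakDeriv_tsum (fun m => h.continuous_layer m n)
    (h.summable_layer_bound n) (fun m u => h.norm_layer_le m n u)
    (fun m => h.isWeakDeriv_layer hκ m n) (fun m => h.memLp_layerDeriv hκ m n) hsum
  refine ⟨G, hG, hw, ?_, ?_, ?_⟩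
  · filter_upwards [hae, ae_all_iff.2 fun N => h.ae_hasDistortionLE_sum hκ N n] with u hu hu'
    exact (isClosed_hasDistortionLE κ⁻¹).mem_of_tendsto (hu.tendsto_sum_nat.const_add _)
      (Eventually.of_forall hu')
  · filter_upwards [hae] with u hu hux
    simp only [h.layerDeriv_of_gt _ hux] at hu
    exact hu.unique hasSum_zero
  · filter_upwards [hae] with u hu hux hux' K' hK'
    have e : G u = bumpDeriv x y t κ n u := by
      refine hu.unique ?_
      have hz : ∀ m, m ≠ 0 → layerDeriv x y t κ m n u = 0 := fun m hm => by
        obtain ⟨m, rfl⟩ := Nat.exists_eq_succ_of_ne_zero hm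
        have h1 := norm_sub_norm_le u ((t * x (n + 1) / 2 : ℝ) : ℂ)
        have h2 := norm_sub_norm_le u (-((t * x (n + 1) / 2 : ℝ) : ℂ))
        rw [norm_neg, sub_neg_eq_add] at h2
        rw [h.norm_center] at h1 h2
        have h3 := mul_le_mul_of_nonneg_right h.four_le (h.pos_x (n + 1)).le
        have h4 := h.pos_x (n + 1)
        rw [layerDeriv, h.layerDeriv_of_gt m (by linarith), h.layerDeriv_of_gt m (by linarith),
          add_zero]
      exact hasSum_single 0 hz
    rw [e] at hK'
    exact h.inv_le_of_hasDistortionLE hκ hux hux' hK'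

end ScaleDerivative

/-! ### Local index and degree of maps whose fibres are {z, -z}. -/

section Degree

theorem localIndex_eq_one {f : ℂ → ℂ} {x : ℂ} {U : Set ℂ} (hU : U ∈ 𝓝 x) (h : Set.InjOn f U) :
    localIndex f x = 1 := by
  apply le_antisymm
  · refine (iInf₂_le U hU).trans (iSup_le fun y => ?_)
    rw [Set.encard_le_one_iff]
    rintro a c ⟨ha, haU⟩ ⟨hc, hcU⟩
    exact h haU hcU (ha.trans hc.symm)
  · refine le_iInf₂ fun V hV => le_iSup_of_le (f x) ?_
    exact Set.one_le_encard_iff_nonempty.2 ⟨x, rfl, mem_of_mem_nhds hV⟩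

/-- The disc of radius ‖z‖ about z cannot contain both a and -a, since that would give 2‖z‖ < 2‖z‖.
-/
theorem localIndex_of_ne_zero {f : ℂ → ℂ} (hf : ∀ z w, f z = f w ↔ w = z ∨ w = -z) {z : ℂ}
    (hz : z ≠ 0) : localIndex f z = 1 := by
  refine localIndex_eq_one (Metric.ball_mem_nhds z (norm_pos_iff.2 hz)) fun a ha c hc hac => ?_
  rcases (hf a c).1 hac with rfl | rfl
  · rfl
  · rw [Metric.mem_ball, dist_eq_norm] at ha hc
    have h1 := norm_add_le (a - z) (-a - z)
    have h2 : a - z + (-a - z) = -(2 * z) := by ring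
    rw [h2, norm_neg, norm_mul, Complex.norm_ofNat] at h1
    linarith

theorem preimage_singleton_of_even {f : ℂ → ℂ} (hf : ∀ z w, f z = f w ↔ w = z ∨ w = -z) (z : ℂ) :
    f ⁻¹' {f z} = {z, -z} := by
  ext w
  rw [Set.mem_preimage, Set.mem_singleton_iff, eq_comm, hf z w]
  rfl

theorem localIndex_zero {f : ℂ → ℂ} (hf : ∀ z w, f z = f w ↔ w = z ∨ w = -z) :
    localIndex f 0 = 2 := by
  apply le_antisymm
  · refine (iInf₂_le Set.univ univ_mem).trans (iSup_le fun y => ?_)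
    rw [Set.inter_univ]
    rcases (f ⁻¹' {y}).eq_empty_or_nonempty with h | ⟨z, rfl⟩
    · simp [h]
    · rw [preimage_singleton_of_even hf]
      exact (Set.encard_insert_le _ _).trans (by rw [Set.encard_singleton]; norm_num)
  · refine le_iInf₂ fun V hV => ?_
    obtain ⟨ε, hε, hεV⟩ := Metric.mem_nhds_iff.1 hV
    have hw : ‖((ε / 2 : ℝ) : ℂ)‖ < ε := by
      rw [Complex.norm_real, Real.norm_of_nonneg (by linarith)]
      linarith
    have hw0 : ((ε / 2 : ℝ) : ℂ) ≠ 0 := by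
      rw [Complex.ofReal_ne_zero]
      linarith
    refine le_iSup_of_le (f ((ε / 2 : ℝ) : ℂ)) ?_
    rw [preimage_singleton_of_even hf, Set.inter_eq_left.2, Set.encard_pair]
    · exact fun h => hw0 (self_eq_neg.1 h)
    · rintro w (rfl | rfl)
      · exact hεV (by simpa using hw)
      · exact hεV (by simpa using hw)

theorem hasDegree_two {f : ℂ → ℂ} (hf : ∀ z w, f z = f w ↔ w = z ∨ w = -z)
    (hs : Function.Surjective f) : HasDegree f 2 := by
  intro y
  obtain ⟨z, rfl⟩ := hs y
  rw [preimage_singleton_of_even hf]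
  rcases eq_or_ne z 0 with rfl | hz
  · rw [neg_zero, Set.pair_eq_singleton, tsum_singleton (0 : ℂ) (localIndex f), localIndex_zero hf]
    rfl
  · have hne : z ≠ -z := fun h => hz (self_eq_neg.1 h)
    have e : ({z, -z} : Set ℂ) = (({z, -z} : Finset ℂ) : Set ℂ) := by simp
    rw [e, Finset.tsum_subtype' ({z, -z} : Finset ℂ) (localIndex f), Finset.sum_pair hne,
      localIndex_of_ne_zero hf hz, localIndex_of_ne_zero hf (neg_ne_zero.2 hz)]
    norm_num

end Degree

/-! ### The quasiregular map and its factorization through the square. -/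

section Construction

/-- The radii of the discs in the construction of the Cantor set. -/
noncomputable def cantorRadius (K b : ℝ) : ℕ → ℝ
  | 0 => 4 * b
  | n + 1 => cantorRadius K b n / (b * 2 ^ (K ^ n))

variable {K b : ℝ}

theorem cantorRadius_pos (hb : 0 < b) (n : ℕ) : 0 < cantorRadius K b n := by
  induction n with
  | zero => rw [cantorRadius]; positivity
  | succ n ih => rw [cantorRadius]; positivity

/-- The initial radius 4 b is chosen for this value: the centres b r₁ / 2 then lie at ±b, and the
slope r₀ / r₁ = 2 b is the derivative of the square at b. -/
theorem cantorRadius_one (hb : 0 < b) : cantorRadius K b 1 = 2 := by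
  simp only [cantorRadius, pow_zero, Real.rpow_one]
  field_simp
  norm_num

theorem one_le_two_rpow_pow (hK : 1 < K) (n : ℕ) : (1 : ℝ) ≤ 2 ^ (K ^ n) :=
  Real.one_le_rpow one_le_two (by positivity)

theorem cantorRadius_ratio (hb : 0 < b) (n : ℕ) :
    b * cantorRadius K b (n + 1) / cantorRadius K b n = (2 ^ (K ^ n))⁻¹ := by
  have := cantorRadius_pos (K := K) hb n
  rw [cantorRadius]
  field_simp

theorem mul_cantorRadius_succ_le (hK : 1 < K) (hb : 0 < b) (n : ℕ) :
    b * cantorRadius K b (n + 1) ≤ cantorRadius K b n := by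
  have h1 := cantorRadius_pos (K := K) hb n
  have h2 := cantorRadius_ratio (K := K) hb n
  have h3 := one_le_two_rpow_pow hK n
  rw [← div_le_one h1, h2]
  exact inv_le_one_of_one_le₀ h3

/-- The source radii are the target radii shifted by one level, and 2 ^ (-K ^ n) is the power K⁻¹ of
2 ^ (-K ^ (n + 1)). This fixes the form of the radii. -/
theorem isScale_cantorRadius (hK : 1 < K) (hb : 4 ≤ b) :
    IsScale (fun n => cantorRadius K b (n + 1)) (cantorRadius K b) b K⁻¹ where
  pos_x n := cantorRadius_pos (by linarith) _
  pos_y n := cantorRadius_pos (by linarith) _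
  four_le := hb
  pos_exp := by positivity
  x_succ n := mul_cantorRadius_succ_le hK (by linarith) _
  y_succ n := mul_cantorRadius_succ_le hK (by linarith) _
  ratio n := by
    rw [cantorRadius_ratio (by linarith), cantorRadius_ratio (by linarith),
      Real.inv_rpow (by positivity), ← Real.rpow_mul (by norm_num), pow_succ, mul_assoc,
      mul_inv_cancel₀ (by positivity), mul_one]

/-- This uses K < 2: then K ^ (n + 2) ≤ 2 K ^ (n + 1), so the growth of the slopes is beaten by the
shrinking of the supports, and b ≥ 4 supplies the factor 4. -/
theorem cantorRadius_decay (hK : 1 < K) (hK2 : K < 2) (hb : 4 ≤ b) (n : ℕ) :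
    4 * (cantorRadius K b (n + 2) / cantorRadius K b (n + 3) * cantorRadius K b (n + 2)) ≤
      cantorRadius K b (n + 1) / cantorRadius K b (n + 2) * cantorRadius K b (n + 1) := by
  have hb0 : 0 < b := by linarith
  have h1 := cantorRadius_pos (K := K) hb0 (n + 1)
  have e2 : cantorRadius K b (n + 2) = cantorRadius K b (n + 1) / (b * 2 ^ (K ^ (n + 1))) := rfl
  have e3 : cantorRadius K b (n + 3) = cantorRadius K b (n + 2) / (b * 2 ^ (K ^ (n + 2))) := rfl
  have h2 : (2 : ℝ) ^ (K ^ (n + 2)) ≤ 2 ^ (K ^ (n + 1)) * 2 ^ (K ^ (n + 1)) := by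
    rw [← Real.rpow_add two_pos]
    apply Real.rpow_le_rpow_of_exponent_le one_le_two
    have : 0 < K ^ (n + 1) := by positivity
    rw [pow_succ K (n + 1)]
    nlinarith
  rw [e3, e2]
  set r := cantorRadius K b (n + 1)
  set A : ℝ := 2 ^ (K ^ (n + 2))
  set B : ℝ := 2 ^ (K ^ (n + 1))
  have hA : 0 < A := Real.rpow_pos_of_pos two_pos _
  have hB : 0 < B := Real.rpow_pos_of_pos two_pos _
  have e4 : 4 * (r / (b * B) / (r / (b * B) / (b * A)) * (r / (b * B))) = 4 * A * r / B := by
    field_simp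
  have e5 : r / (r / (b * B)) * r = b * B * r := by field_simp
  rw [e4, e5, div_le_iff₀ hB]
  calc 4 * A * r ≤ 4 * (B * B) * r := by gcongr
    _ ≤ b * (B * B) * r := by gcongr
    _ = _ := by ring

/-- The square function, cut off outside the disc of radius `2`. -/
noncomputable def cutSquare (u : ℂ) : ℂ := (max 0 (min 1 (3 - ‖u‖)) : ℝ) • u ^ 2

theorem cutSquare_of_le {u : ℂ} (hu : ‖u‖ ≤ 2) : cutSquare u = u ^ 2 := by
  rw [cutSquare, min_eq_left (by linarith), max_eq_right zero_le_one, one_smul]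

theorem cutSquare_of_ge {u : ℂ} (hu : 3 ≤ ‖u‖) : cutSquare u = 0 := by
  rw [cutSquare, max_eq_left ((min_le_right _ _).trans (by linarith)), zero_smul]

theorem cutSquare_neg (u : ℂ) : cutSquare (-u) = cutSquare u := by
  simp [cutSquare]

theorem lipschitz_cutSquare : LipschitzWith 15 cutSquare := by
  refine LipschitzWith.of_dist_le_mul fun u v => ?_
  rw [dist_eq_norm, dist_eq_norm, NNReal.coe_ofNat]
  wlog huv : ‖u‖ ≤ ‖v‖ generalizing u v
  · rw [norm_sub_rev, norm_sub_rev u v]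
    exact this v u (le_of_not_ge huv)
  set c : ℂ → ℝ := fun u => max 0 (min 1 (3 - ‖u‖)) with hc
  have hcl : |c u - c v| ≤ ‖u - v‖ := by
    refine (abs_max_sub_max_le_max _ _ _ _).trans ?_
    rw [sub_self, abs_zero]
    refine max_le (norm_nonneg _) ((abs_min_sub_min_le_max _ _ _ _).trans ?_)
    rw [sub_self, abs_zero]
    refine max_le (norm_nonneg _) ?_
    rw [sub_sub_sub_cancel_left, norm_sub_rev]
    exact abs_norm_sub_norm_le v u
  have hc0 : 0 ≤ c v := le_max_left _ _
  have hc1 : c v ≤ 1 := max_le zero_le_one (min_le_left _ _)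
  rcases le_total 3 ‖u‖ with h3 | h3
  · rw [cutSquare_of_ge h3, cutSquare_of_ge (h3.trans huv), sub_zero, norm_zero]
    positivity
  -- A discrete product rule. The cutoff is 1-Lipschitz and ‖u‖² ≤ 9, giving 9; where the cutoff of
  -- v is nonzero ‖u + v‖ ≤ 6, giving 6; hence the constant 15.
  have e : cutSquare u - cutSquare v = (c u - c v) • u ^ 2 + c v • ((u - v) * (u + v)) := by
    simp only [cutSquare, hc, Complex.real_smul]
    push_cast
    ring
  rw [e]
  have h1 : ‖(c u - c v) • u ^ 2‖ ≤ 9 * ‖u - v‖ := by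
    rw [norm_smul, norm_pow, Real.norm_eq_abs]
    have : ‖u‖ ^ 2 ≤ 9 := by nlinarith [norm_nonneg u]
    calc |c u - c v| * ‖u‖ ^ 2 ≤ ‖u - v‖ * 9 := by gcongr
      _ = _ := mul_comm _ _
  have h2 : ‖c v • ((u - v) * (u + v))‖ ≤ 6 * ‖u - v‖ := by
    rw [norm_smul, norm_mul, Real.norm_of_nonneg hc0]
    rcases le_total 3 ‖v‖ with hv | hv
    · have : c v = 0 := max_eq_left ((min_le_right _ _).trans (by linarith))
      rw [this, zero_mul]
      positivity
    · have h4 : ‖u + v‖ ≤ 6 := (norm_add_le _ _).trans (by linarith)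
      calc c v * (‖u - v‖ * ‖u + v‖) ≤ 1 * (‖u - v‖ * 6) := by gcongr
        _ = _ := by ring
  linarith [norm_add_le ((c u - c v) • u ^ 2) (c v • ((u - v) * (u + v)))]

/-- A perturbation of `z ^ 2 - b ^ 2` that is affine near `b` and near `-b`. -/
noncomputable def affinizedSquare (b : ℝ) (z : ℂ) : ℂ :=
  z ^ 2 - b ^ 2 - cutSquare (z - b) - cutSquare (z + b)

/-- The correction on all levels of the Cantor construction. -/
noncomputable def cantorBump (K b : ℝ) : ℂ → ℂ :=
  bumpSum (fun n => cantorRadius K b (n + 1)) (cantorRadius K b) b K⁻¹ 0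

/-- The quasiregular map of degree two with small set of bounded orbits. -/
noncomputable def cantorSquare (K b : ℝ) (z : ℂ) : ℂ :=
  affinizedSquare b z + cantorBump K b (z - b) - cantorBump K b (z + b)

theorem cantorBump_neg (u : ℂ) : cantorBump K b (-u) = - cantorBump K b u := bumpSum_neg _ _

theorem cantorBump_of_ge (hK : 1 < K) (hb : 4 ≤ b) {u : ℂ} (hu : 2 ≤ ‖u‖) :
    cantorBump K b u = 0 :=
  (isScale_cantorRadius hK hb).bumpSum_of_ge
    (by simpa [cantorRadius_one (K := K) (show 0 < b by linarith)] using hu)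

theorem continuous_cantorBump (hK : 1 < K) (hb : 4 ≤ b) : Continuous (cantorBump K b) :=
  (isScale_cantorRadius hK hb).continuous_bumpSum 0

theorem cantorMap_zero_eq (hb : 0 < b) (u : ℂ) :
    cantorMap (fun n => cantorRadius K b (n + 1)) (cantorRadius K b) b K⁻¹ 0 u =
      2 * b * u + cantorBump K b u := by
  rw [cantorMap, cantorBump]
  have : cantorRadius K b 0 / cantorRadius K b (0 + 1) = 2 * b := by
    rw [zero_add, cantorRadius_one hb, cantorRadius]
    ring
  rw [this, Complex.real_smul]
  push_cast
  rfl

theorem affinizedSquare_neg (z : ℂ) : affinizedSquare b (-z) = affinizedSquare b z := by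
  rw [affinizedSquare, affinizedSquare, show -z - (b : ℂ) = -(z + b) by ring,
    show -z + (b : ℂ) = -(z - b) by ring, cutSquare_neg, cutSquare_neg]
  ring

theorem cantorSquare_neg (z : ℂ) : cantorSquare K b (-z) = cantorSquare K b z := by
  rw [cantorSquare, cantorSquare, show -z - (b : ℂ) = -(z + b) by ring,
    show -z + (b : ℂ) = -(z - b) by ring, cantorBump_neg, cantorBump_neg, affinizedSquare_neg]
  ring

theorem continuous_affinizedSquare (b : ℝ) : Continuous (affinizedSquare b) := by
  have := lipschitz_cutSquare.continuous
  unfold affinizedSquare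
  fun_prop

theorem continuous_cantorSquare (hK : 1 < K) (hb : 4 ≤ b) : Continuous (cantorSquare K b) := by
  have := continuous_cantorBump hK hb
  have := continuous_affinizedSquare b
  unfold cantorSquare
  fun_prop

theorem norm_two_mul_ofReal (hb : 0 ≤ b) : ‖(2 * b : ℂ)‖ = 2 * b := by
  rw [norm_mul, Complex.norm_ofNat, Complex.norm_real, Real.norm_of_nonneg hb]

/-- Points close to `b` are far from `-b`. -/
theorem le_norm_add_of_norm_sub_le (hb : 0 ≤ b) {z : ℂ} {r : ℝ} (hz : ‖z - b‖ ≤ r) :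
    2 * b - r ≤ ‖z + b‖ := by
  have h1 := norm_sub_norm_le (2 * b : ℂ) (-(z - b))
  rw [show (2 * b : ℂ) - -(z - b) = z + b by ring, norm_two_mul_ofReal hb, norm_neg] at h1
  linarith

theorem le_norm_sub_of_norm_add_le (hb : 0 ≤ b) {z : ℂ} {r : ℝ} (hz : ‖z + b‖ ≤ r) :
    2 * b - r ≤ ‖z - b‖ := by
  have := le_norm_add_of_norm_sub_le hb (z := -z) (r := r)
    (by rw [show -z - (b : ℂ) = -(z + b) by ring, norm_neg]; exact hz)
  rwa [show -z + (b : ℂ) = -(z - b) by ring, norm_neg] at this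

theorem affinizedSquare_center (hb : 4 ≤ b) {v : ℂ} (hv : ‖v‖ ≤ 2) :
    affinizedSquare b (b + v) = 2 * b * v := by
  have h1 := le_norm_add_of_norm_sub_le (b := b) (by linarith) (z := b + v) (r := 2) (by simpa using hv)
  rw [affinizedSquare, cutSquare_of_ge (u := b + v + b) (by linarith),
    cutSquare_of_le (u := b + v - b) (by simpa using hv)]
  ring

theorem cantorSquare_center (hK : 1 < K) (hb : 4 ≤ b) {v : ℂ} (hv : ‖v‖ ≤ 2) :
    cantorSquare K b (b + v) =
      cantorMap (fun n => cantorRadius K b (n + 1)) (cantorRadius K b) b K⁻¹ 0 v := by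
  have h1 := le_norm_add_of_norm_sub_le (b := b) (by linarith) (z := b + v) (r := 2) (by simpa using hv)
  rw [cantorSquare, affinizedSquare_center hb hv, cantorBump_of_ge hK hb (u := b + v + b)
    (by linarith), cantorMap_zero_eq (by linarith), add_sub_cancel_left, sub_zero]

theorem cantorSquare_outer (hK : 1 < K) (hb : 4 ≤ b) {z : ℂ} (h1 : 3 ≤ ‖z - b‖) (h2 : 3 ≤ ‖z + b‖) :
    cantorSquare K b z = z ^ 2 - b ^ 2 := by
  rw [cantorSquare, affinizedSquare, cutSquare_of_ge h1, cutSquare_of_ge h2,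
    cantorBump_of_ge hK hb (by linarith), cantorBump_of_ge hK hb (by linarith)]
  ring

theorem exists_sq_eq_re_nonneg (w : ℂ) : ∃ s : ℂ, s ^ 2 = w ∧ 0 ≤ s.re := by
  obtain ⟨s, hs⟩ := IsAlgClosed.exists_pow_nat_eq w two_pos
  rcases le_total 0 s.re with h | h
  · exact ⟨s, hs, h⟩
  · exact ⟨-s, by rw [neg_sq, hs], by simpa using h⟩

/-- Solving w - E w = v means finding the fixed point of the contraction w ↦ v + E w. -/
theorem bijective_id_sub {E : ℂ → ℂ} {c : NNReal} (hc : c < 1) (hE : LipschitzWith c E) :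
    Function.Bijective fun w => w - E w := by
  constructor
  · intro w w' h
    have h0 : w - E w = w' - E w' := h
    have h1 := hE.dist_le_mul w w'
    rw [dist_eq_norm, dist_eq_norm, show E w - E w' = w - w' by linear_combination -h0] at h1
    have hc' : (c : ℝ) < 1 := hc
    have h3 : ‖w - w'‖ = 0 := by nlinarith [norm_nonneg (w - w')]
    exact sub_eq_zero.1 (norm_eq_zero.1 h3)
  · intro v
    have hL : ContractingWith c fun w => v + E w :=
      ⟨hc, LipschitzWith.of_dist_le_mul fun w w' => by
        rw [dist_add_left]; exact hE.dist_le_mul w w'⟩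
    refine ⟨hL.fixedPoint, ?_⟩
    have := hL.fixedPoint_isFixedPt
    rw [Function.IsFixedPt] at this
    linear_combination -this

/-- The affinized square is a homeomorphism composed with the square function. -/
theorem exists_bijective_affinizedSquare (hb : 33 ≤ b) :
    ∃ D : ℂ → ℂ, Function.Bijective D ∧ ∀ z, affinizedSquare b z = D (z ^ 2) := by
  -- The root need not be continuous: its real part is nonnegative, so the cutoff at -b vanishes,
  -- and only roots near b matter in the Lipschitz estimate.
  choose s hs hre using exists_sq_eq_re_nonneg
  have hadd : ∀ w, 3 ≤ ‖s w + b‖ := fun w => by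
    have h1 := Complex.re_le_norm (s w + b)
    have := hre w
    simp only [Complex.add_re, Complex.ofReal_re] at h1
    linarith
  have hE : LipschitzWith (1 / 2) fun w => cutSquare (s w - b) + cutSquare (s w + b) := by
    refine LipschitzWith.of_dist_le_mul fun w w' => ?_
    simp only [cutSquare_of_ge (hadd _), add_zero]
    have key : ∀ w w', ‖s w - b‖ ≤ 3 →
        dist (cutSquare (s w - b)) (cutSquare (s w' - b)) ≤ 1 / 2 * dist w w' := by
      intro w w' h
      have h1 := lipschitz_cutSquare.dist_le_mul (s w - b) (s w' - b)
      rw [dist_eq_norm (s w - b), sub_sub_sub_cancel_right, NNReal.coe_ofNat] at h1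
      have h2 : w - w' = (s w - s w') * (s w + s w') := by
        rw [← sub_eq_zero]
        linear_combination -(hs w) + hs w'
      -- The real part of s w is at least b - 3, which explains b ≥ 33. Against the Lipschitz
      -- constant 15 of the cut-off square this yields contraction factor 1/2.
      have h3 : 30 ≤ ‖s w + s w'‖ := by
        have h4 := Complex.re_le_norm (s w + s w')
        have h5 := (Complex.abs_re_le_norm (s w - b)).trans h
        have h6 := hre w'
        simp only [Complex.add_re, Complex.sub_re, Complex.ofReal_re] at h4 h5
        have := (abs_le.1 h5).1
        linarith
      rw [dist_eq_norm w, h2, norm_mul]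
      nlinarith [norm_nonneg (s w - s w')]
    push_cast
    rcases le_total ‖s w - b‖ 3 with h1 | h1
    · exact key w w' h1
    rcases le_total ‖s w' - b‖ 3 with h2 | h2
    · rw [dist_comm, dist_comm w w']
      exact key w' w h2
    · rw [cutSquare_of_ge h1, cutSquare_of_ge h2, dist_self]
      positivity
  have hbij := bijective_id_sub (by rw [← NNReal.coe_lt_coe]; norm_num) hE
  refine ⟨fun w => (w - (cutSquare (s w - b) + cutSquare (s w + b))) - b ^ 2,
    (Equiv.subRight ((b : ℂ) ^ 2)).bijective.comp hbij, fun z => ?_⟩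
  have h1 : s (z ^ 2) = z ∨ s (z ^ 2) = -z := sq_eq_sq_iff_eq_or_eq_neg.1 (hs _)
  rcases h1 with h1 | h1
  · simp only [h1, affinizedSquare]
    ring
  · simp only [h1]
    rw [← affinizedSquare_neg, affinizedSquare]
    ring

/-- The Cantor map differs from a linear map only on the disc of radius 2, and the preimage of that
disc under the rescaled affinized square consists of the discs of radius 2 about ±b. Adding bumps at
±b thus amounts to composing with the Cantor map. -/
theorem cantorSquare_eq (hK : 1 < K) (hb : 33 ≤ b) (z : ℂ) : cantorSquare K b z =
    cantorMap (fun n => cantorRadius K b (n + 1)) (cantorRadius K b) b K⁻¹ 0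
      (affinizedSquare b z / (2 * b)) := by
  have hb0 : (2 * b : ℂ) ≠ 0 := by
    rw [← norm_pos_iff, norm_two_mul_ofReal (by linarith)]
    linarith
  have center : ∀ v : ℂ, ‖v‖ ≤ 2 → cantorSquare K b (b + v) =
      cantorMap (fun n => cantorRadius K b (n + 1)) (cantorRadius K b) b K⁻¹ 0
      (affinizedSquare b (b + v) / (2 * b)) := fun v hv => by
    rw [cantorSquare_center hK (by linarith) hv, affinizedSquare_center (by linarith) hv,
      mul_div_cancel_left₀ _ hb0]
  rcases le_total ‖z - b‖ 2 with h1 | h1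
  · have := center _ h1
    rwa [add_sub_cancel] at this
  rcases le_total ‖z + b‖ 2 with h2 | h2
  · have := center (-(z + b)) (by rwa [norm_neg])
    rwa [show (b : ℂ) + -(z + b) = -z by ring, affinizedSquare_neg, cantorSquare_neg] at this
  -- A value inside the disc is already attained near b by the affine formula; injectivity of D
  -- would place z near b or -b.
  have h3 : 2 ≤ ‖affinizedSquare b z / (2 * b)‖ := by
    by_contra! hcon
    obtain ⟨D, hD, hDz⟩ := exists_bijective_affinizedSquare hb
    have h4 := affinizedSquare_center (b := b) (by linarith) hcon.le
    rw [mul_div_cancel₀ _ hb0, hDz z, hDz] at h4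
    rcases sq_eq_sq_iff_eq_or_eq_neg.1 (hD.1 h4) with h5 | h5
    · have h6 : z - b = D (z ^ 2) / (2 * b) := by linear_combination -h5
      rw [h6, ← hDz] at h1
      linarith
    · have h6 : z + b = -(D (z ^ 2) / (2 * b)) := by linear_combination h5
      rw [h6, ← hDz, norm_neg] at h2
      linarith
  rw [cantorMap_zero_eq (by linarith), cantorBump_of_ge hK (by linarith) h3, cantorSquare,
    cantorBump_of_ge hK (by linarith) h1, cantorBump_of_ge hK (by linarith) h2,
    mul_div_cancel₀ _ hb0]
  ring

theorem exists_bijective_cantorSquare (hK : 1 < K) (hb : 33 ≤ b) :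
    ∃ D : ℂ → ℂ, Function.Bijective D ∧ ∀ z, cantorSquare K b z = D (z ^ 2) := by
  obtain ⟨D, hD, hDz⟩ := exists_bijective_affinizedSquare hb
  have hb0 : (2 * b : ℂ) ≠ 0 := by
    rw [← norm_pos_iff, norm_two_mul_ofReal (by linarith)]
    linarith
  refine ⟨fun w => cantorMap (fun n => cantorRadius K b (n + 1)) (cantorRadius K b) b K⁻¹ 0
      (D w / (2 * b)), ?_, fun z => ?_⟩
  · exact ((isScale_cantorRadius hK (by linarith)).bijective_cantorMap 0).comp
      ((Equiv.divRight₀ (2 * b : ℂ) hb0).bijective.comp hD)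
  · rw [cantorSquare_eq hK hb, hDz]

theorem cantorSquare_eq_iff (hK : 1 < K) (hb : 33 ≤ b) (z w : ℂ) :
    cantorSquare K b z = cantorSquare K b w ↔ w = z ∨ w = -z := by
  obtain ⟨D, hD, hDz⟩ := exists_bijective_cantorSquare hK hb
  rw [hDz, hDz, hD.1.eq_iff, ← sq_eq_sq_iff_eq_or_eq_neg, eq_comm]

theorem surjective_cantorSquare (hK : 1 < K) (hb : 33 ≤ b) :
    Function.Surjective (cantorSquare K b) := by
  obtain ⟨D, hD, hDz⟩ := exists_bijective_cantorSquare hK hb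
  intro y
  obtain ⟨w, rfl⟩ := hD.2 y
  obtain ⟨s, rfl, -⟩ := exists_sq_eq_re_nonneg w
  exact ⟨s, hDz s⟩

theorem hasDegree_cantorSquare (hK : 1 < K) (hb : 33 ≤ b) : HasDegree (cantorSquare K b) 2 :=
  hasDegree_two (cantorSquare_eq_iff hK hb) (surjective_cantorSquare hK hb)

end Construction

/-! ### Escape to infinity, bounded orbits and the Julia set. -/

section Dynamics

variable {K b : ℝ}

theorem two_mul_norm_le_cantorSquare (hK : 1 < K) (hb : 33 ≤ b) {z : ℂ} (hz : 4 * b ≤ ‖z‖) :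
    2 * ‖z‖ ≤ ‖cantorSquare K b z‖ := by
  have hbn : ‖(b : ℂ)‖ = b := by rw [Complex.norm_real, Real.norm_of_nonneg (by linarith)]
  have h1 := norm_sub_norm_le z (b : ℂ)
  have h2 := norm_sub_norm_le z (-(b : ℂ))
  rw [norm_neg, sub_neg_eq_add] at h2
  rw [cantorSquare_outer hK (by linarith) (by linarith) (by linarith)]
  have h3 := norm_sub_norm_le (z ^ 2) ((b : ℂ) ^ 2)
  rw [norm_pow, norm_pow, hbn] at h3
  nlinarith

theorem isPolynomialType_cantorSquare (hK : 1 < K) (hb : 33 ≤ b) :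
    IsPolynomialType (cantorSquare K b) := by
  refine tendsto_atTop_mono' _ ?_ (tendsto_norm_cocompact_atTop (E := ℂ))
  filter_upwards [(tendsto_norm_cocompact_atTop (E := ℂ)).eventually_ge_atTop (4 * b)] with z hz
  linarith [two_mul_norm_le_cantorSquare hK hb hz, norm_nonneg z]

theorem norm_iterate_cantorSquare (hK : 1 < K) (hb : 33 ≤ b) {z : ℂ} (hz : 4 * b ≤ ‖z‖) (k : ℕ) :
    2 ^ k * ‖z‖ ≤ ‖(cantorSquare K b)^[k] z‖ := by
  induction k with
  | zero => simp
  | succ k ih =>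
    rw [Function.iterate_succ_apply']
    have h1 : (1 : ℝ) ≤ 2 ^ k := one_le_pow₀ one_le_two
    have h2 : 4 * b ≤ ‖(cantorSquare K b)^[k] z‖ := by nlinarith [norm_nonneg z]
    have h3 := two_mul_norm_le_cantorSquare hK hb h2
    rw [pow_succ]
    linarith

theorem mem_boundedOrbits_iff {f : ℂ → ℂ} {z : ℂ} :
    z ∈ boundedOrbits f ↔ Bornology.IsBounded (Set.range fun k : ℕ => f^[k] z) := Iff.rfl

theorem boundedOrbits_cantorSquare (hK : 1 < K) (hb : 33 ≤ b) :
    boundedOrbits (cantorSquare K b) = {z | ∀ k, ‖(cantorSquare K b)^[k] z‖ ≤ 4 * b} := by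
  ext z
  constructor
  · intro hz k
    by_contra! hcon
    obtain ⟨C, hC⟩ := isBounded_iff_forall_norm_le.1 (mem_boundedOrbits_iff.1 hz)
    obtain ⟨j, hj⟩ := pow_unbounded_of_one_lt C one_lt_two
    have h1 := norm_iterate_cantorSquare hK hb hcon.le j
    rw [← Function.iterate_add_apply] at h1
    have h2 := hC _ (Set.mem_range_self (j + k))
    have h3 : (0 : ℝ) < 2 ^ j := by positivity
    nlinarith
  · intro hz
    refine mem_boundedOrbits_iff.2 (isBounded_iff_forall_norm_le.2 ⟨4 * b, ?_⟩)
    rintro _ ⟨k, rfl⟩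
    exact hz k

theorem map_mem_boundedOrbits_iff (f : ℂ → ℂ) (z : ℂ) :
    f z ∈ boundedOrbits f ↔ z ∈ boundedOrbits f := by
  have e : Set.range (fun k : ℕ => f^[k] z) = {z} ∪ Set.range fun k : ℕ => f^[k] (f z) := by
    ext w
    simp only [Set.mem_range, Set.mem_union, Set.mem_singleton_iff]
    constructor
    · rintro ⟨k, rfl⟩
      rcases k with _ | k
      · exact Or.inl rfl
      · exact Or.inr ⟨k, rfl⟩
    · rintro (rfl | ⟨k, rfl⟩)
      · exact ⟨0, rfl⟩
      · exact ⟨k + 1, rfl⟩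
  rw [mem_boundedOrbits_iff, mem_boundedOrbits_iff, e, Bornology.isBounded_union]
  exact ⟨fun h => ⟨Bornology.isBounded_singleton, h⟩, fun h => h.2⟩

theorem isCompact_boundedOrbits (hK : 1 < K) (hb : 33 ≤ b) :
    IsCompact (boundedOrbits (cantorSquare K b)) := by
  have hc := continuous_cantorSquare hK (b := b) (by linarith)
  rw [boundedOrbits_cantorSquare hK hb]
  refine Metric.isCompact_of_isClosed_isBounded ?_ ?_
  · rw [Set.ofPred_forall]
    exact isClosed_iInter fun k => isClosed_le (hc.iterate k).norm continuous_const
  · exact isBounded_iff_forall_norm_le.2 ⟨4 * b, fun z hz => hz 0⟩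

theorem nonempty_boundedOrbits (hK : 1 < K) (hb : 33 ≤ b) :
    (boundedOrbits (cantorSquare K b)).Nonempty := by
  have hc := continuous_cantorSquare hK (b := b) (by linarith)
  set f := cantorSquare K b with hf
  let X : ℕ → Set ℂ := fun n => {z | ∀ k ≤ n, ‖f^[k] z‖ ≤ 4 * b}
  have hclosed : ∀ n, IsClosed (X n) := fun n => by
    simp only [X, Set.ofPred_forall]
    exact isClosed_iInter fun k => isClosed_iInter fun _ =>
      isClosed_le (hc.iterate k).norm continuous_const
  have hne : ∀ n, (X n).Nonempty := fun n => by
    -- A point with f^n(z) = 0 cannot leave the disc of radius 4 b before time n, since orbits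
    -- outside it keep growing.
    obtain ⟨z, hz⟩ := (surjective_cantorSquare hK hb).iterate n 0
    refine ⟨z, fun k hk => ?_⟩
    by_contra! hcon
    have h1 := norm_iterate_cantorSquare hK hb hcon.le (n - k)
    rw [← hf, ← Function.iterate_add_apply, Nat.sub_add_cancel hk, hz, norm_zero] at h1
    have h3 : (0 : ℝ) < 2 ^ (n - k) := by positivity
    nlinarith
  obtain ⟨z, hz⟩ := IsCompact.nonempty_iInter_of_sequence_nonempty_isCompact_isClosed X
    (fun n z hz k hk => hz k (hk.trans n.le_succ)) hne
    (Metric.isCompact_of_isClosed_isBounded (hclosed 0)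
      (isBounded_iff_forall_norm_le.2 ⟨4 * b, fun z hz => hz 0 le_rfl⟩)) hclosed
  refine ⟨z, ?_⟩
  rw [hf, boundedOrbits_cantorSquare hK hb]
  exact fun k => Set.mem_iInter.1 hz k k le_rfl

theorem zero_notMem_boundedOrbits (hK : 1 < K) (hb : 33 ≤ b) :
    (0 : ℂ) ∉ boundedOrbits (cantorSquare K b) := by
  rw [boundedOrbits_cantorSquare hK hb]
  intro h
  have hbn : ‖(b : ℂ)‖ = b := by rw [Complex.norm_real, Real.norm_of_nonneg (by linarith)]
  have h1 := h 1
  rw [Function.iterate_one, cantorSquare_outer hK (by linarith) (by rw [zero_sub, norm_neg, hbn]; linarith)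
    (by rw [zero_add, hbn]; linarith), zero_pow two_ne_zero, zero_sub, norm_neg, norm_pow, hbn] at h1
  nlinarith

/-- Take z of bounded orbit and w with f(w) = -f(z). As f is even and 0 escapes, z, -z and w are
distinct points of bounded orbit. The strict bound is what excludes them from the Julia set's
exceptional allowance of two points. -/
theorem two_lt_encard_boundedOrbits (hK : 1 < K) (hb : 33 ≤ b) :
    2 < (boundedOrbits (cantorSquare K b)).encard := by
  set f := cantorSquare K b with hf
  have h0 := zero_notMem_boundedOrbits hK hb
  have hneg : ∀ z ∈ boundedOrbits f, -z ∈ boundedOrbits f := fun z hz => by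
    rw [← map_mem_boundedOrbits_iff, hf, cantorSquare_neg, ← hf, map_mem_boundedOrbits_iff]
    exact hz
  obtain ⟨z, hz⟩ := nonempty_boundedOrbits hK hb
  have hne : ∀ w ∈ boundedOrbits f, w ≠ -w := fun w hw h =>
    h0 (by rw [← self_eq_neg.1 h]; exact hw)
  obtain ⟨w, hw⟩ := surjective_cantorSquare hK hb (-(f z))
  have hfz : f z ∈ boundedOrbits f := (map_mem_boundedOrbits_iff f z).2 hz
  have hw' : w ∈ boundedOrbits f := by
    rw [← map_mem_boundedOrbits_iff, hf, hw]
    exact hneg _ hfz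
  have hwz : ¬ (w = z ∨ w = -z) := fun h => by
    rw [← cantorSquare_eq_iff hK hb, hw] at h
    exact hne _ hfz h
  push Not at hwz
  have hsub : ({w, z, -z} : Set ℂ) ⊆ boundedOrbits f := by
    rintro v (rfl | rfl | rfl)
    · exact hw'
    · exact hz
    · exact hneg _ hz
  refine lt_of_lt_of_le ?_ (Set.encard_le_encard hsub)
  rw [Set.encard_insert_of_notMem (by simpa using hwz), Set.encard_pair (hne z hz)]
  norm_num

/-- The complement of the bounded orbits is an open forward invariant neighbourhood of each of its
points, infinity included, and its forward orbit misses more than two points. -/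
theorem juliaSet_subset (hK : 1 < K) (hb : 33 ≤ b) : juliaSet (cantorSquare K b) ⊆
    (fun z : ℂ => (z : OnePoint ℂ)) '' boundedOrbits (cantorSquare K b) := by
  set f := cantorSquare K b with hf
  intro z hz
  by_contra hcon
  have hco := isCompact_boundedOrbits hK hb
  have hopen : IsOpen ((fun z : ℂ => (z : OnePoint ℂ)) '' boundedOrbits f)ᶜ :=
    OnePoint.isOpen_compl_image_coe.2 ⟨hco.isClosed, hco⟩
  set U := ((fun z : ℂ => (z : OnePoint ℂ)) '' boundedOrbits f)ᶜ with hU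
  have hmaps : Set.MapsTo (OnePoint.map f) U U := by
    intro w hw
    induction w using OnePoint.rec with
    | infty =>
      rw [OnePoint.map_infty]
      exact hw
    | coe w =>
      rintro ⟨v, hv, hvw⟩
      rw [OnePoint.map_some] at hvw
      have := OnePoint.coe_injective hvw
      rw [this, map_mem_boundedOrbits_iff] at hv
      exact hw ⟨w, hv, rfl⟩
  have h1 := hz U (hopen.mem_nhds hcon)
  have h2 : (fun z : ℂ => (z : OnePoint ℂ)) '' boundedOrbits f ⊆
      (⋃ k : ℕ, (OnePoint.map f)^[k] '' U)ᶜ := by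
    rw [Set.subset_compl_comm]
    exact Set.iUnion_subset fun k => (hmaps.iterate k).image_subset
  have h3 := (Set.encard_le_encard h2).trans h1
  rw [OnePoint.coe_injective.encard_image] at h3
  exact absurd h3 (not_le.2 (two_lt_encard_boundedOrbits hK hb))

theorem cantorLevel_shift (x : ℕ → ℝ) (t : ℝ) (l n : ℕ) :
    cantorLevel (fun n => x (n + 1)) t l n = cantorLevel x t l (n + 1) := by
  induction l generalizing n with
  | zero => rfl
  | succ l ih => simp only [cantorLevel, ih]

theorem neg_mem_cantorLevel {x : ℕ → ℝ} {t : ℝ} {l n : ℕ} {u : ℂ} (hu : u ∈ cantorLevel x t l n) :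
    -u ∈ cantorLevel x t l n := by
  induction l generalizing n u with
  | zero => simpa [cantorLevel] using hu
  | succ l ih =>
    obtain ⟨v, hv, hu⟩ := hu
    refine ⟨-v, ih hv, ?_⟩
    rcases hu with rfl | rfl
    · exact Or.inr (by ring)
    · exact Or.inl (by ring)

theorem boundedOrbits_subset_cantorLevel (hK : 1 < K) (hb : 33 ≤ b) (l : ℕ) :
    boundedOrbits (cantorSquare K b) ⊆ cantorLevel (cantorRadius K b) b l 0 := by
  have hs := isScale_cantorRadius hK (b := b) (by linarith)
  induction l with
  | zero =>
    intro z hz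
    rw [boundedOrbits_cantorSquare hK hb] at hz
    exact mem_closedBall_zero_iff.2 (hz 0)
  | succ l ih =>
    intro z hz
    have h1 := ih ((map_mem_boundedOrbits_iff _ z).2 hz)
    -- The inverse Cantor map pulls f(z) back to a point v of the shifted level set. Then b + v has
    -- the same image as z, so z = ±(b + v).
    have h2 := hs.symm.mapsTo_cantorLevel l 0 h1
    have h3 := hs.symm.cantorMap_cantorMap 0 (cantorSquare K b z)
    simp only [inv_inv] at h2 h3
    set v := cantorMap (cantorRadius K b) (fun n => cantorRadius K b (n + 1)) b K 0
      (cantorSquare K b z) with hv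
    have h4 := mem_closedBall_zero_iff.1 (hs.cantorLevel_subset _ _ h2)
    simp only [zero_add, cantorRadius_one (K := K) (show 0 < b by linarith)] at h4
    rw [← cantorSquare_center hK (b := b) (by linarith) h4, cantorSquare_eq_iff hK hb] at h3
    rw [cantorLevel_shift] at h2
    have hc : ((b * cantorRadius K b (0 + 1) / 2 : ℝ) : ℂ) = b := by
      rw [zero_add, cantorRadius_one (by linarith)]
      congr 1
      ring
    rcases h3 with h3 | h3
    · exact ⟨v, h2, Or.inl (by rw [hc, h3])⟩
    · exact ⟨-v, neg_mem_cantorLevel h2, Or.inr (by rw [hc, h3]; ring)⟩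

end Dynamics

/-! ### Gauge measure and Hausdorff dimension. -/

section Measure

variable {K b : ℝ}

theorem two_mul_cantorRadius_le (hK : 1 < K) (hb : 33 ≤ b) (n : ℕ) :
    2 * cantorRadius K b (n + 2) ≤ 2 ^ (-(K ^ n)) := by
  have hs := isScale_cantorRadius hK (b := b) (by linarith)
  have h1 : cantorRadius K b (n + 1) ≤ 2 := by
    induction n with
    | zero => exact (cantorRadius_one (by linarith)).le
    | succ n ih => linarith [hs.x_le n, hs.pos_x n, hs.pos_x (n + 1)]
  have e : cantorRadius K b (n + 2) = cantorRadius K b (n + 1) / (b * 2 ^ (K ^ (n + 1))) := rfl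
  have h2 : (2 : ℝ) ^ (K ^ n) ≤ 2 ^ (K ^ (n + 1)) :=
    Real.rpow_le_rpow_of_exponent_le one_le_two (pow_le_pow_right₀ hK.le n.le_succ)
  have h3 : (0 : ℝ) < 2 ^ (K ^ n) := by positivity
  rw [e, Real.rpow_neg two_pos.le, ← one_div, mul_div_assoc', div_le_div_iff₀ (by positivity) h3]
  nlinarith

/-- The cover is by the discs of level n + 2. The hypothesis ranges over all small diameters because
the gauge is not assumed monotone. -/
theorem mkMetric_boundedOrbits_le (hK : 1 < K) (hb : 33 ≤ b) (m : ℝ≥0∞ → ℝ≥0∞) {C : ℝ≥0∞}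
    (hm : ∀ᶠ n : ℕ in atTop, ∀ e ≤ ENNReal.ofReal (2 ^ (-(K ^ n))), 2 ^ (n + 2) * m e ≤ C) :
    Measure.mkMetric m (boundedOrbits (cantorSquare K b)) ≤ C := by
  choose s hs hcov using fun n => exists_cover_cantorLevel (cantorRadius K b) b (n + 2) 0
  have hdiam : ∀ (n : ℕ) (a : ℂ), Metric.ediam (Metric.closedBall a (cantorRadius K b (n + 2))) ≤
      ENNReal.ofReal (2 ^ (-(K ^ n))) := fun n a => by
    refine Metric.ediam_le fun z hz w hw => ?_
    rw [edist_dist]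
    refine ENNReal.ofReal_le_ofReal ((dist_triangle_right z w a).trans ?_)
    have := two_mul_cantorRadius_le hK hb n
    linarith [Metric.mem_closedBall.1 hz, Metric.mem_closedBall.1 hw]
  have hlim : Tendsto (fun n : ℕ => ENNReal.ofReal (2 ^ (-(K ^ n)))) atTop (𝓝 0) := by
    rw [← ENNReal.ofReal_zero]
    refine ENNReal.tendsto_ofReal ?_
    have h1 : Tendsto (fun n : ℕ => K ^ n) atTop atTop := tendsto_pow_atTop_atTop_of_one_lt hK
    exact (tendsto_rpow_atBot_of_base_gt_one 2 one_lt_two).comp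
      (tendsto_neg_atTop_atBot.comp h1)
  refine (Measure.mkMetric_le_liminf_sum (ι := fun n => s n) _ _ hlim
    (fun n a => Metric.closedBall (a : ℂ) (cantorRadius K b (n + 2)))
    (Eventually.of_forall fun n a => hdiam n a) (Eventually.of_forall fun n z hz => ?_) m).trans ?_
  · obtain ⟨a, ha, hza⟩ := Set.mem_iUnion₂.1
      (hcov n (boundedOrbits_subset_cantorLevel hK hb (n + 2) hz))
    rw [zero_add] at hza
    exact Set.mem_iUnion.2 ⟨⟨a, ha⟩, hza⟩
  · rw [← liminf_const (f := (atTop : Filter ℕ)) C]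
    refine liminf_le_liminf ?_
    filter_upwards [hm] with n hn
    set M := ⨆ e ≤ ENNReal.ofReal (2 ^ (-(K ^ n))), m e with hM
    have h1 : ∀ a : s n, m (Metric.ediam (Metric.closedBall (a : ℂ) (cantorRadius K b (n + 2)))) ≤ M :=
      fun a => le_iSup₂_of_le _ (hdiam n a) le_rfl
    refine (Finset.sum_le_card_nsmul _ _ M fun a _ => h1 a).trans ?_
    rw [nsmul_eq_mul, Finset.card_univ, Fintype.card_coe]
    have h2 : ((s n).card : ℝ≥0∞) ≤ 2 ^ (n + 2) := by exact_mod_cast hs n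
    refine (mul_le_mul_left h2 M).trans ?_
    rw [hM]
    simp only [ENNReal.mul_iSup]
    exact iSup₂_le hn

theorem gaugeMeasure_boundedOrbits_lt_top (hK : 1 < K) (hb : 33 ≤ b) {h : ℝ → ℝ}
    (hh : h = fun t => (Real.log (1 / t)) ^ (-(Real.log 2 / Real.log K))) :
    gaugeMeasure h (boundedOrbits (cantorSquare K b)) < ⊤ := by
  have hlogK : 0 < Real.log K := Real.log_pos hK
  have hlog2 : 0 < Real.log 2 := Real.log_pos one_lt_two
  set a := Real.log 2 / Real.log K with ha
  refine (mkMetric_boundedOrbits_le (C := ENNReal.ofReal (4 * (Real.log 2) ^ (-a))) hK hb _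
    (Eventually.of_forall fun n e he => ?_)).trans_lt ENNReal.ofReal_lt_top
  rcases eq_or_ne e 0 with rfl | he0
  · simp
  have hd0 : 0 < e.toReal := ENNReal.toReal_pos he0 (ne_top_of_le_ne_top ENNReal.ofReal_ne_top he)
  have hd1 : e.toReal ≤ 2 ^ (-(K ^ n)) := ENNReal.toReal_le_of_le_ofReal (by positivity) he
  have hKn : 0 < K ^ n := by positivity
  have h1 : K ^ n * Real.log 2 ≤ Real.log (1 / e.toReal) := by
    have := Real.log_le_log hd0 hd1
    rw [Real.log_rpow two_pos] at this
    rw [one_div, Real.log_inv]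
    linarith
  have h2 : h e.toReal ≤ (K ^ n * Real.log 2) ^ (-a) := by
    rw [hh]
    exact Real.rpow_le_rpow_of_nonpos (by positivity) h1 (by rw [neg_nonpos]; positivity)
  -- The exponent a = log 2 / log K is the one with K ^ a = 2, so the gauge cancels the number of
  -- discs up to the factor 4.
  have h3 : (K ^ n : ℝ) ^ (-a) = (2 ^ n)⁻¹ := by
    rw [Real.rpow_def_of_pos hKn, Real.log_pow, ha,
      show (n * Real.log K) * -(Real.log 2 / Real.log K) = -(n * Real.log 2) by field_simp,
      Real.exp_neg, ← Real.log_pow, Real.exp_log (by positivity)]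
  rw [Real.mul_rpow hKn.le hlog2.le, h3] at h2
  rw [if_neg he0, show (2 : ℝ≥0∞) ^ (n + 2) = ENNReal.ofReal (2 ^ (n + 2)) by
    rw [ENNReal.ofReal_pow two_pos.le, ENNReal.ofReal_ofNat], ← ENNReal.ofReal_mul (by positivity)]
  refine ENNReal.ofReal_le_ofReal ?_
  calc (2 : ℝ) ^ (n + 2) * h e.toReal ≤ 2 ^ (n + 2) * ((2 ^ n)⁻¹ * Real.log 2 ^ (-a)) := by gcongr
    _ = 4 * Real.log 2 ^ (-a) := by
      rw [pow_add]
      field_simp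
      norm_num

theorem dimH_boundedOrbits (hK : 1 < K) (hb : 33 ≤ b) :
    dimH (boundedOrbits (cantorSquare K b)) = 0 := by
  by_contra hne
  obtain ⟨d, hd0, hd⟩ := ENNReal.lt_iff_exists_nnreal_btwn.1 (pos_iff_ne_zero.2 hne)
  have hd0 : (0 : ℝ) < d := by exact_mod_cast hd0
  refine absurd (dimH_le_of_hausdorffMeasure_ne_top (ne_top_of_le_ne_top ENNReal.one_ne_top ?_))
    (not_le.2 hd)
  -- Since (n + 2) / K ^ n → 0, eventually 2 ^ (n + 2) is at most 2 ^ (d K ^ n), so the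
  -- d-dimensional sums are at most 1.
  have hlim : Tendsto (fun n : ℕ => ((n : ℝ) ^ 1 / K ^ n + 2 * (K⁻¹) ^ n)) atTop (𝓝 (0 + 2 * 0)) :=
    (tendsto_pow_const_div_const_pow_of_one_lt 1 hK).add
      ((tendsto_pow_atTop_nhds_zero_of_lt_one (by positivity) (inv_lt_one_of_one_lt₀ hK)).const_mul 2)
  rw [mul_zero, add_zero] at hlim
  refine mkMetric_boundedOrbits_le hK hb _ ?_
  filter_upwards [hlim.eventually (gt_mem_nhds hd0)] with n hn e he
  have hKn : 0 < K ^ n := by positivity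
  have h1 : (n : ℝ) + 2 ≤ d * K ^ n := by
    have e1 : (n : ℝ) ^ 1 / K ^ n + 2 * (K⁻¹) ^ n = (n + 2) / K ^ n := by
      rw [inv_pow]
      field_simp
    rw [e1, div_lt_iff₀ hKn] at hn
    exact hn.le
  calc 2 ^ (n + 2) * e ^ (d : ℝ)
      ≤ 2 ^ (n + 2) * (ENNReal.ofReal (2 ^ (-(K ^ n)))) ^ (d : ℝ) := by gcongr
    _ = ENNReal.ofReal (2 ^ ((n : ℝ) + 2 - d * K ^ n)) := by
      rw [ENNReal.ofReal_rpow_of_pos (by positivity), ← Real.rpow_mul two_pos.le,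
        show (2 : ℝ≥0∞) ^ (n + 2) = ENNReal.ofReal (2 ^ ((n : ℝ) + 2)) by
          rw [← ENNReal.ofReal_ofNat, ← ENNReal.ofReal_pow two_pos.le, ← Real.rpow_natCast]
          push_cast
          rfl, ← ENNReal.ofReal_mul (by positivity), ← Real.rpow_add two_pos]
      congr 2
      ring
    _ ≤ 1 := by
      rw [ENNReal.ofReal_le_one]
      exact Real.rpow_le_one_of_one_le_of_nonpos one_le_two (by linarith)

end Measure

/-! ### Weak derivative and exact dilatation of the map. -/

section Quasiregular

variable {K b : ℝ}

theorem fderiv_cutSquare_of_lt {u : ℂ} (hu : ‖u‖ < 2) :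
    fderiv ℝ cutSquare u = (2 * u) • ContinuousLinearMap.id ℝ ℂ := by
  have : cutSquare =ᶠ[𝓝 u] fun v => v ^ 2 := by
    filter_upwards [continuous_norm.continuousAt.eventually (gt_mem_nhds hu)] with v hv
    exact cutSquare_of_le (le_of_lt hv)
  have hd : HasFDerivAt (fun v : ℂ => v ^ 2) ((2 * u) • ContinuousLinearMap.id ℝ ℂ) u := by
    have h1 := ((hasDerivAt_pow 2 u).hasFDerivAt).restrictScalars ℝ
    refine h1.congr_fderiv ?_
    ext z
    simp
    ring
  rw [this.fderiv_eq, hd.fderiv]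

theorem fderiv_cutSquare_of_gt {u : ℂ} (hu : 3 < ‖u‖) : fderiv ℝ cutSquare u = 0 := by
  have : cutSquare =ᶠ[𝓝 u] fun _ => 0 := by
    filter_upwards [continuous_norm.continuousAt.eventually (lt_mem_nhds hu)] with v hv
    exact cutSquare_of_ge (le_of_lt hv)
  rw [this.fderiv_eq, fderiv_const_apply]

theorem norm_fderiv_cutSquare_le (u : ℂ) : ‖fderiv ℝ cutSquare u‖ ≤ 15 :=
  norm_fderiv_le_of_lipschitz ℝ lipschitz_cutSquare

/-- The derivative of the affinized square. -/
noncomputable def affinizedSquareDeriv (b : ℝ) (z : ℂ) : ℂ →L[ℝ] ℂ :=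
  (2 * z) • ContinuousLinearMap.id ℝ ℂ -
    (fderiv ℝ cutSquare (z - b) + fderiv ℝ cutSquare (z + b))

theorem memLp_affinizedSquareDeriv (b : ℝ) {s : Set ℂ} (hs : IsCompact s) :
    MemLp (affinizedSquareDeriv b) 2 (volume.restrict s) := by
  have hfin : IsFiniteMeasure (volume.restrict s) := ⟨by
    rw [Measure.restrict_apply_univ]; exact hs.measure_lt_top⟩
  have hm : Measurable (affinizedSquareDeriv b) := by
    have h1 := measurable_fderiv ℝ cutSquare
    have h2 : Continuous fun z : ℂ => (2 * z) • ContinuousLinearMap.id ℝ ℂ := by fun_prop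
    unfold affinizedSquareDeriv
    exact h2.measurable.sub ((h1.comp (measurable_id.sub_const _)).add
      (h1.comp (measurable_id.add_const _)))
  obtain ⟨C, hC⟩ := hs.isBounded.exists_norm_le
  refine MemLp.of_bound hm.aestronglyMeasurable (2 * C + 30) ?_
  filter_upwards [ae_restrict_mem hs.measurableSet] with z hz
  have h1 := hC z hz
  have h2 := norm_fderiv_cutSquare_le (z - b)
  have h3 := norm_fderiv_cutSquare_le (z + b)
  have h4 : ‖(2 * z) • ContinuousLinearMap.id ℝ ℂ‖ ≤ 2 * C := by
    refine (norm_smul_le (2 * z) (ContinuousLinearMap.id ℝ ℂ)).trans ?_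
    rw [ContinuousLinearMap.norm_id, mul_one, norm_mul, Complex.norm_ofNat]
    linarith
  refine (norm_sub_le_of_le h4 (norm_add_le_of_le h2 h3)).trans (by linarith)

theorem locallyIntegrable_of_memLp_compact {g : ℂ → (ℂ →L[ℝ] ℂ)}
    (hg : ∀ s : Set ℂ, IsCompact s → MemLp g 2 (volume.restrict s)) : LocallyIntegrable g := by
  rw [locallyIntegrable_iff]
  intro s hs
  have hfin : IsFiniteMeasure (volume.restrict s) := ⟨by
    rw [Measure.restrict_apply_univ]; exact hs.measure_lt_top⟩
  exact (hg s hs).integrable one_le_two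

theorem isWeakDeriv_affinizedSquare (b : ℝ) :
    IsWeakDeriv (affinizedSquare b) (affinizedSquareDeriv b) := by
  have h0 : IsWeakDeriv (fun z : ℂ => z ^ 2 - (b : ℂ) ^ 2)
      fun z => (2 * z) • ContinuousLinearMap.id ℝ ℂ := by
    refine isWeakDeriv_of_hasFDerivAt (fun z => ?_) (by fun_prop)
    have h1 := (((hasDerivAt_pow 2 z).sub_const ((b : ℂ) ^ 2)).hasFDerivAt).restrictScalars ℝ
    refine h1.congr_fderiv ?_
    ext w
    simp
    ring
  have hc := lipschitz_cutSquare.continuous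
  have hl : LocallyIntegrable (fderiv ℝ cutSquare) := lipschitz_cutSquare.locallyIntegrable_fderiv
  have ht : ∀ a : ℂ, IsWeakDeriv (fun z => - cutSquare (z - a))
      (fun z => - fderiv ℝ cutSquare (z - a)) := fun a =>
    (lipschitz_cutSquare.isWeakDeriv.comp_sub_const a).neg
  have hli : ∀ a : ℂ, LocallyIntegrable fun z => - fderiv ℝ cutSquare (z - a) := fun a => by
    have hm := ((measurable_fderiv ℝ cutSquare).comp (measurable_id.sub_const a)).neg
    refine (memLp_top_of_bound hm.aestronglyMeasurable 15
      (ae_of_all _ fun z => ?_)).locallyIntegrable le_top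
    exact (norm_neg _).trans_le (norm_fderiv_cutSquare_le _)
  have h1 := h0.add (ht b) (by fun_prop) (by fun_prop)
    (by fun_prop : Continuous fun z : ℂ => (2 * z) • ContinuousLinearMap.id ℝ ℂ).locallyIntegrable
    (hli b)
  have h2 := h1.add (ht (-(b : ℂ))) (by fun_prop) (by fun_prop)
    (locallyIntegrable_add
      (by fun_prop : Continuous fun z : ℂ => (2 * z) • ContinuousLinearMap.id ℝ ℂ).locallyIntegrable
      (hli b)) (hli (-(b : ℂ)))
  refine (congrArg₂ IsWeakDeriv (funext fun z => ?_) (funext fun z => ?_)).mp h2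
  · rw [affinizedSquare, sub_neg_eq_add]
    ring
  · rw [affinizedSquareDeriv, sub_neg_eq_add]
    abel

theorem real_smul_id_eq (c : ℝ) :
    c • ContinuousLinearMap.id ℝ ℂ = (c : ℂ) • ContinuousLinearMap.id ℝ ℂ := by
  ext z
  simp

theorem affinizedSquareDeriv_near (hb : 33 ≤ b) {z : ℂ} (hz : ‖z - b‖ < 2) :
    affinizedSquareDeriv b z = (2 * b) • ContinuousLinearMap.id ℝ ℂ := by
  have h1 := le_norm_add_of_norm_sub_le (b := b) (by linarith) hz.le
  rw [affinizedSquareDeriv, fderiv_cutSquare_of_lt hz, fderiv_cutSquare_of_gt (by linarith), add_zero,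
    real_smul_id_eq]
  ext w
  simp
  ring

theorem affinizedSquareDeriv_near_neg (hb : 33 ≤ b) {z : ℂ} (hz : ‖z + b‖ < 2) :
    affinizedSquareDeriv b z = -((2 * b) • ContinuousLinearMap.id ℝ ℂ) := by
  have h1 := le_norm_sub_of_norm_add_le (b := b) (by linarith) hz.le
  rw [affinizedSquareDeriv, fderiv_cutSquare_of_lt hz, fderiv_cutSquare_of_gt (by linarith), zero_add,
    real_smul_id_eq]
  ext w
  simp
  ring

/-- Within distance 3 of ±b the conformal part 2 z has modulus at least 2 (b - 3), while the cutoff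
perturbs it by at most 15; `hKb` says that this is small enough. Elsewhere the derivative is
conformal. -/
theorem hasDistortionLE_affinizedSquareDeriv (hK : 1 < K) (hb : 33 ≤ b)
    (hKb : (K + 1) * 15 ≤ (K - 1) * (2 * (b - 3) - 15)) {z : ℂ} (h1 : ‖z - b‖ ≠ 3)
    (h2 : ‖z + b‖ ≠ 3) : HasDistortionLE K (affinizedSquareDeriv b z) := by
  have hbn : ‖(b : ℂ)‖ = b := by rw [Complex.norm_real, Real.norm_of_nonneg (by linarith)]
  have key : b - 3 ≤ ‖z‖ → ∀ B : ℂ →L[ℝ] ℂ, ‖B‖ ≤ 15 →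
      HasDistortionLE K ((2 * z) • ContinuousLinearMap.id ℝ ℂ - B) := fun hz B hB => by
    refine hasDistortionLE_smul_id_sub hK.le hB (hKb.trans ?_)
    rw [norm_mul, Complex.norm_ofNat]
    apply mul_le_mul_of_nonneg_left <;> linarith
  rcases lt_or_gt_of_ne h1 with h3 | h3
  · have h5 := le_norm_add_of_norm_sub_le (b := b) (by linarith) h3.le
    have h6 := norm_sub_norm_le (b : ℂ) (-(z - b))
    rw [norm_neg, sub_neg_eq_add, add_sub_cancel, hbn] at h6
    rw [affinizedSquareDeriv, fderiv_cutSquare_of_gt (u := z + b) (by linarith), add_zero]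
    exact key (by linarith) _ (norm_fderiv_cutSquare_le _)
  rcases lt_or_gt_of_ne h2 with h4 | h4
  · have h6 := norm_sub_norm_le (b : ℂ) (z + b)
    rw [sub_add_cancel_right, norm_neg, hbn] at h6
    rw [affinizedSquareDeriv, fderiv_cutSquare_of_gt h3, zero_add]
    exact key (by linarith) _ (norm_fderiv_cutSquare_le _)
  · rw [affinizedSquareDeriv, fderiv_cutSquare_of_gt h3, fderiv_cutSquare_of_gt h4, add_zero,
      sub_zero]
    exact hasDistortionLE_smul_id hK.le _

theorem exists_weakDeriv_cantorSquare (hK : 1 < K) (hK2 : K < 2) (hb : 33 ≤ b)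
    (hKb : (K + 1) * 15 ≤ (K - 1) * (2 * (b - 3) - 15)) :
    ∃ g : ℂ → (ℂ →L[ℝ] ℂ), IsWeakDeriv (cantorSquare K b) g ∧
      (∀ s : Set ℂ, IsCompact s → MemLp g 2 (volume.restrict s)) ∧
      (∀ᵐ z : ℂ, HasDistortionLE K (g z)) ∧
      ∀ᵐ z : ℂ, ‖z - b‖ < 2 → b * cantorRadius K b 2 < ‖z - b‖ →
        ∀ K' : ℝ, HasDistortionLE K' (g z) → K ≤ K' := by
  have hs := isScale_cantorRadius hK (b := b) (by linarith)
  obtain ⟨G, hG, hw, hdist, hzero, hmin⟩ := hs.exists_weakDeriv_bumpSum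
    (inv_le_one_of_one_le₀ hK.le) (cantorRadius_decay hK hK2 (by linarith)) 0
  have hw : IsWeakDeriv (cantorBump K b) G := hw
  have hslope : cantorRadius K b 0 / cantorRadius K b (0 + 1) = 2 * b := by
    rw [zero_add, cantorRadius_one (by linarith), cantorRadius]
    ring
  simp only [hslope, inv_inv] at hdist hmin
  simp only [zero_add, cantorRadius_one (K := K) (show 0 < b by linarith)] at hzero hmin
  have hG1 := MemLp.comp_sub_const_clm hG b
  have hG2 := MemLp.comp_sub_const_clm hG (-b)
  have hw1 := hw.comp_sub_const b
  have hw2 := hw.comp_sub_const (-b)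
  have d1 := ae_comp_sub_const hdist b
  have d2 := ae_comp_sub_const hdist (-b)
  have z1 := ae_comp_sub_const hzero b
  have z2 := ae_comp_sub_const hzero (-b)
  have m1 := ae_comp_sub_const hmin b
  have j2 := ae_norm_sub_ne (-(b : ℂ)) 2
  have j4 := ae_norm_sub_ne (-(b : ℂ)) 3
  simp only [sub_neg_eq_add] at hG2 hw2 d2 z2 j2 j4
  have hcb := continuous_cantorBump hK (b := b) (by linarith)
  have hcq := continuous_affinizedSquare b
  have hlq := locallyIntegrable_of_memLp_compact fun s hs => memLp_affinizedSquareDeriv b hs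
  have hl1 := memLp_two_locallyIntegrable hG1
  have hl2 := (memLp_two_locallyIntegrable hG2).neg
  have hA := (isWeakDeriv_affinizedSquare b).add hw1 hcq (by fun_prop) hlq hl1
  have hB := hA.add hw2.neg (by fun_prop) (by fun_prop) (locallyIntegrable_add hlq hl1) hl2
  refine ⟨fun z => affinizedSquareDeriv b z + G (z - b) + -G (z + b), ?_, fun s hs => ?_, ?_, ?_⟩
  · refine (congrArg₂ IsWeakDeriv (funext fun z => ?_) rfl).mp hB
    rw [cantorSquare, sub_eq_add_neg _ (cantorBump K b (z + b))]
  · exact memLp_two_add (memLp_two_add (memLp_affinizedSquareDeriv b hs) (hG1.restrict s))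
      (hG2.restrict s).neg
  · filter_upwards [d1, d2, z1, z2, ae_norm_sub_ne (b : ℂ) 2, j2, ae_norm_sub_ne (b : ℂ) 3, j4]
      with z d1 d2 z1 z2 j1 j2 j3 j4
    rcases lt_or_gt_of_ne j1 with k1 | k1
    · have k2 := le_norm_add_of_norm_sub_le (b := b) (by linarith) k1.le
      rw [affinizedSquareDeriv_near hb k1, z2 (by linarith), neg_zero, add_zero]
      exact d1
    rcases lt_or_gt_of_ne j2 with k2 | k2
    · rw [affinizedSquareDeriv_near_neg hb k2, z1 k1, add_zero, ← neg_add]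
      exact d2.neg
    · rw [z1 k1, z2 k2, neg_zero, add_zero, add_zero]
      exact hasDistortionLE_affinizedSquareDeriv hK hb hKb j3 j4
  · filter_upwards [m1, z2] with z m1 z2 k1 k3 K' hK'
    have k2 := le_norm_add_of_norm_sub_le (b := b) (by linarith) k1.le
    rw [affinizedSquareDeriv_near hb k1, z2 (by linarith), neg_zero, add_zero] at hK'
    exact m1 k1 k3 K' hK'

theorem hasDilatation_cantorSquare (hK : 1 < K) (hK2 : K < 2) (hb : 33 ≤ b)
    (hKb : (K + 1) * 15 ≤ (K - 1) * (2 * (b - 3) - 15)) : HasDilatation (cantorSquare K b) K := by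
  obtain ⟨g, hw, hmem, hdist, hmin⟩ := exists_weakDeriv_cantorSquare hK hK2 hb hKb
  refine ⟨⟨hK.le, continuous_cantorSquare hK (by linarith), g, hw, hmem, hdist⟩, ?_⟩
  rintro K' ⟨-, -, g', hw', hmem', hdist'⟩
  have hae := hw.ae_eq hw' (locallyIntegrable_of_memLp_compact hmem)
    (locallyIntegrable_of_memLp_compact hmem')
  -- The outermost annulus about b on which the map is a pure radial stretch. It is open and
  -- nonempty, hence not null, so all the a.e. statements hold at some common point of it.
  set U : Set ℂ := Metric.ball (b : ℂ) 2 ∩ (Metric.closedBall (b : ℂ) (b * cantorRadius K b 2))ᶜ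
    with hU
  have hUo : IsOpen U := Metric.isOpen_ball.inter Metric.isClosed_closedBall.isOpen_compl
  have hmemU : ∀ z, z ∈ U ↔ ‖z - b‖ < 2 ∧ b * cantorRadius K b 2 < ‖z - b‖ := fun z => by
    rw [hU, Set.mem_inter_iff, Set.mem_compl_iff, mem_ball_iff_norm, mem_closedBall_iff_norm, not_le]
  have hr : b * cantorRadius K b 2 < 2 := by
    have h1 := cantorRadius_ratio (K := K) (b := b) (by linarith) 1
    rw [cantorRadius_one (by linarith), pow_one] at h1
    have h2 : (2 : ℝ) ^ (1 : ℝ) < 2 ^ K := Real.rpow_lt_rpow_of_exponent_lt one_lt_two hK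
    rw [Real.rpow_one] at h2
    have h3 : ((2 : ℝ) ^ K)⁻¹ < 1 := inv_lt_one_of_one_lt₀ (by linarith)
    have h4 : b * cantorRadius K b 2 / 2 < 1 := h1 ▸ h3
    linarith
  have hUne : U.Nonempty := by
    have hpos : 0 < b * cantorRadius K b 2 :=
      mul_pos (by linarith) (cantorRadius_pos (by linarith) _)
    obtain ⟨s, hs1, hs2⟩ := exists_between hr
    refine ⟨b + s, (hmemU _).2 ⟨?_, ?_⟩⟩ <;>
      rw [add_sub_cancel_left, Complex.norm_real, Real.norm_of_nonneg (by linarith)] <;> assumption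
  have hfreq : ∃ᵐ z, z ∈ U := by
    rw [frequently_ae_mem_iff]
    exact (hUo.measure_pos volume hUne).ne'
  obtain ⟨z, hz, hgg, hd, hm⟩ := (hfreq.and_eventually (hae.and (hdist'.and hmin))).exists
  obtain ⟨hz1, hz2⟩ := (hmemU z).1 hz
  refine hm hz1 hz2 K' ?_
  rw [hgg]
  exact hd

end Quasiregular

theorem theorem2 (K : ℝ) (hK : K ∈ Set.Ioo (1 : ℝ) 2) (h : ℝ → ℝ)
    (hh : h = fun t => (Real.log (1 / t)) ^ (-(Real.log 2 / Real.log K))) :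
    ∃ f : ℂ → ℂ,
      IsQuasiregularMap f ∧ IsPolynomialType f ∧ HasDegree f 2 ∧ HasDilatation f K ∧
      OnePoint.infty ∉ juliaSet f ∧
      gaugeMeasure h ((fun z : ℂ => (z : OnePoint ℂ)) ⁻¹' juliaSet f) ≤
        gaugeMeasure h (boundedOrbits f) ∧
      gaugeMeasure h (boundedOrbits f) < ⊤ ∧
      dimH ((fun z : ℂ => (z : OnePoint ℂ)) ⁻¹' juliaSet f) = 0 ∧
      dimH (boundedOrbits f) = 0 := by
  obtain ⟨hK1, hK2⟩ := hK
  obtain ⟨b, hb, hKb⟩ : ∃ b : ℝ, 33 ≤ b ∧ (K + 1) * 15 ≤ (K - 1) * (2 * (b - 3) - 15) := by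
    have hK0 : 0 < K - 1 := by linarith
    -- The summand 33 serves the contraction argument; 30 / (K - 1) makes the right side 45 (K - 1)
    -- + 60, which exceeds 15 (K + 1).
    refine ⟨33 + 30 / (K - 1), by linarith [div_pos (by norm_num : (0 : ℝ) < 30) hK0], ?_⟩
    have : (K - 1) * (2 * (33 + 30 / (K - 1) - 3) - 15) = 45 * (K - 1) + 60 := by
      field_simp
      ring
    rw [this]
    linarith
  have hdil := hasDilatation_cantorSquare hK1 hK2 hb hKb
  have hJ := juliaSet_subset hK1 hb
  have hsub : (fun z : ℂ => (z : OnePoint ℂ)) ⁻¹' juliaSet (cantorSquare K b) ⊆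
      boundedOrbits (cantorSquare K b) := by
    intro z hz
    obtain ⟨w, hw, hwz⟩ := hJ hz
    rwa [← OnePoint.coe_injective hwz]
  have hdim := dimH_boundedOrbits hK1 hb
  refine ⟨cantorSquare K b, ⟨K, hdil.1⟩, isPolynomialType_cantorSquare hK1 hb,
    hasDegree_cantorSquare hK1 hb, hdil, fun hinf => ?_, measure_mono hsub,
    gaugeMeasure_boundedOrbits_lt_top hK1 hb hh, ?_, hdim⟩
  · obtain ⟨w, -, hw⟩ := hJ hinf
    exact OnePoint.coe_ne_infty w hw
  · exact le_antisymm ((dimH_mono hsub).trans hdim.le) (zero_le)
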